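/- Fix $n\ge 2$, $G>0$, $\Lambda>0$ and put $K_\Lambda=\sqrt{\tfrac{n}{n-1}16\pi G\Lambda}$. *Cosmology.* Let $(M_{n+1},g)$ be a smooth connected $(n+1)$-dimensional Lorentzian manifold (signature $-+\dots+$) with a smooth time function $t$ whose gradient is everywhere timelike; the future is the direction in which $t$ increases. For $s\ge t_0$ the slices $\{t=s\}$ are compact Cauchy surfaces, and $\{t=t_0\}$ has mean curvature $K>0$ everywhere ($K$ is the trace of $K_{\mu\nu}=h_\mu{}^\alpha\nabla_\alpha n_\nu$ for the future unit normal $n$, so $K>0$ means expansion). Only the part $t\ge t_0$ is considered below. Let $N^{-1}=\sqrt{-\partial_\mu t\,\partial^\mu t}$ be the inverse lapse. The tensor $T_{\mu\nu}$ defined by $R_{\mu\nu}-\frac12 g_{\mu\nu}R=8\pi G(T_{\mu\nu}-\Lambda g_{\mu\nu})$ satisfies, for $t\ge t_0$ and all future-directed timelike $k$, the dominant energy condition ($-T^\mu{}_\nu k^\nu$ is zero or future-directed timelike or null) and the strong energy condition $(T_{\mu\nu}-\frac1{n-1}g_{\mu\nu}T)k^\mu k^\nu\ge 0$. *Singularities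 only of the crushing kind.* There are an open set $\mathcal N$ containing a Cauchy surface of $M_{n+1}$, a constant $c_0\ge 0$ and a function $\tilde t:M_{n+1}\to\mathbb R$ such that: $N^{-1}$ is bounded outside $\mathcal N$ and, for each $c$, on $\{\tilde t\le c\}$ (always within $t\ge t_0$); and on the set $W=\mathcal N\cap\{\tilde t>c_0\}$, which is open and possibly empty, $\tilde t$ is a smooth time function increasing to the future, with range $(c_0,\infty)$ if $W\neq\emptyset$, whose level sets $\{\tilde t=c\}$, $c>c_0$, are Cauchy surfaces of $W$ with mean curvature $<-c$. *Flow.* Let $M_0$ be a compact smooth $n$-manifold. A mean curvature flow on $[0,\lambda_0)$ is a smooth map $y:M_0\times[0,\lambda_0)\to\{t\ge t_0\}\subset M_{n+1}$ such that every $y(\cdot,\lambda)$ is a spacelike immersion, with image $M_\lambda$, and $\partial_\lambda y=K\,n$, where $n$ and $K$ are the future unit normal and the mean curvature of $y(\cdot,\lambda)$ at $x$. Its height function is $u(x,\lambda)=t(y(x,\lambda))$. **Theorem.** There is a function $C=C(A,B)\ge 0$ (for the fixed $n,G,\Lambda$), with $C(A,B)=AB$ whenever $A\ge0$ and $B\ge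 K_\Lambda$, such that the following holds for every such cosmology. Let $c>c_0$, $\lambda_0>0$, and let $y$ be a mean curvature flow on $[0,\lambda_0)$ with $M_\lambda\subset\{\tilde t<c\}$ for all $\lambda\in[0,\lambda_0)$. Put $$C=C\Big(\sup_{\{\tilde t\le c,\ t\ge t_0\}}N^{-1},\ \sup_{M_0}K\Big),$$ where $\sup_{M_0}K$ is the supremum of the mean curvature of $y(\cdot,0)$. Then $$u(x,\lambda)\le \sup_{x'}u(x',0)+C\lambda\qquad\text{for all }x\in M_0,\ \lambda\in[0,\lambda_0).$$ The same bound holds at $\lambda=\lambda_0$ for every $x$ for which $y(x,\lambda)$ converges in $M_{n+1}$ as $\lambda\uparrow\lambda_0$, with $u(x,\lambda_0)$ the value of $t$ at the limit. In particular, the flow cannot run off to $t=\infty$ in a finite flow parameter. -/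

import Mathlib

open scoped Manifold ContDiff Topology
open Set Filter Bundle

noncomputable section

namespace CosmologyFlow

/-- The model space of an `m`-dimensional manifold. -/
abbrev Coord (m : ℕ) : Type := EuclideanSpace ℝ (Fin m)

/-- The `i`-th standard coordinate vector. -/
def stdVec {m : ℕ} (i : Fin m) : Coord m := EuclideanSpace.single i 1

/-! ### Lorentzian metrics -/

/-- A smooth Lorentzian metric of signature `(-, +, …, +)` on an `m`-dimensional manifold. -/
structure LorentzMetric (m : ℕ) (M : Type*) [TopologicalSpace M] [ChartedSpace (Coord m) M]
    [IsManifold (𝓡 m) ∞ M] where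
  /-- the scalar product on each tangent space -/
  inner : ∀ p : M, TangentSpace (𝓡 m) p →L[ℝ] TangentSpace (𝓡 m) p →L[ℝ] ℝ
  symm : ∀ (p : M) (v w : TangentSpace (𝓡 m) p), inner p v w = inner p w v
  signature : ∀ p : M, ∃ v : TangentSpace (𝓡 m) p, inner p v v < 0 ∧
    ∀ w : TangentSpace (𝓡 m) p, inner p v w = 0 → w ≠ 0 → 0 < inner p w w
  contMDiff : ContMDiff (𝓡 m) ((𝓡 m).prod 𝓘(ℝ, Coord m →L[ℝ] Coord m →L[ℝ] ℝ)) ∞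
    (fun p ↦ TotalSpace.mk' (Coord m →L[ℝ] Coord m →L[ℝ] ℝ)
      (E := fun p : M ↦ TangentSpace (𝓡 m) p →L[ℝ] TangentSpace (𝓡 m) p →L[ℝ] ℝ) p (inner p))

section Manifold

variable {m : ℕ} {M : Type*} [TopologicalSpace M] [ChartedSpace (Coord m) M]

/-- The differential of a real function, as a covector. -/
def differential (f : M → ℝ) (p : M) : TangentSpace (𝓡 m) p →L[ℝ] ℝ :=
  mfderiv (𝓡 m) 𝓘(ℝ, ℝ) f p

/-- The components of a vector field in the preferred chart at `q`, at the coordinate point `z`. -/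
def vectorCoord (X : ∀ p : M, TangentSpace (𝓡 m) p) (q : M) (z : Coord m) : Coord m :=
  mfderiv (𝓡 m) 𝓘(ℝ, Coord m) (extChartAt (𝓡 m) q) ((extChartAt (𝓡 m) q).symm z)
    (X ((extChartAt (𝓡 m) q).symm z))

variable [IsManifold (𝓡 m) ∞ M]

namespace LorentzMetric

variable (g : LorentzMetric m M)

/-- The metric in the preferred chart at `q`, as a bilinear form depending on the coordinate
point `z`. -/
def coord (q : M) (z : Coord m) : Coord m →L[ℝ] Coord m →L[ℝ] ℝ :=
  let D : Coord m →L[ℝ] Coord m :=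
    mfderivWithin 𝓘(ℝ, Coord m) (𝓡 m) (extChartAt (𝓡 m) q).symm (range (𝓡 m)) z
  let b : Coord m →L[ℝ] Coord m →L[ℝ] ℝ := g.inner ((extChartAt (𝓡 m) q).symm z)
  b.bilinearComp D D

/-- The Christoffel symbols `Γ(v, w)` of the Levi-Civita connection in the preferred chart at `q`,
at the coordinate point `z`: the vector with
`g(Γ(v, w), u) = (∂_v g(w, u) + ∂_w g(v, u) - ∂_u g(v, w)) / 2` for all `u`. -/
def christoffel (q : M) (z v w : Coord m) : Coord m :=
  let dg := fderiv ℝ (g.coord q) z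
  (g.coord q z).inverse ((1 / 2 : ℝ) • (dg v w + dg w v - (dg.flip v).flip w))

/-- The Riemann tensor `R(u, v) w = ∇_u ∇_v w - ∇_v ∇_u w - ∇_[u, v] w`, in the preferred chart
at `p`. -/
def riemann (p : M) (u v w : Coord m) : Coord m :=
  let z := extChartAt (𝓡 m) p p
  fderiv ℝ (fun z' ↦ g.christoffel p z' v w) z u - fderiv ℝ (fun z' ↦ g.christoffel p z' u w) z v
    + g.christoffel p z u (g.christoffel p z v w) - g.christoffel p z v (g.christoffel p z u w)

/-- The Ricci tensor at `p`: the trace of `u ↦ R(u, v) w`. -/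
def ricci (p : M) (v w : TangentSpace (𝓡 m) p) : ℝ :=
  ∑ i : Fin m, (g.riemann p (stdVec i) v w) i

/-- The Gram matrix of the metric at `p` in the coordinate basis of the preferred chart at `p`. -/
def gram (p : M) : Matrix (Fin m) (Fin m) ℝ :=
  Matrix.of fun i j ↦ g.inner p (stdVec i : Coord m) (stdVec j : Coord m)

/-- The trace `g^{ij} b_{ij}` of a bilinear form on the tangent space at `p`. -/
def traceForm (p : M) (b : TangentSpace (𝓡 m) p → TangentSpace (𝓡 m) p → ℝ) : ℝ :=
  ∑ i : Fin m, ∑ j : Fin m, (g.gram p)⁻¹ i j * b (stdVec i : Coord m) (stdVec j : Coord m)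

/-- The scalar curvature. -/
def scalar (p : M) : ℝ := g.traceForm p (g.ricci p)

/-- The gradient of a real function with respect to the metric. -/
def grad (f : M → ℝ) (p : M) : TangentSpace (𝓡 m) p :=
  (g.inner p).inverse (differential f p)

/-- The inverse lapse `N⁻¹ = √(-g(∇f, ∇f))` of a time function `f`. -/
def lapseInv (f : M → ℝ) (p : M) : ℝ :=
  √(-(g.inner p (g.grad f p) (g.grad f p)))

/-- The unit normal `-N ∇f` of the level sets of `f`, pointing to increasing values of `f` when
`∇f` is timelike. -/
def levelNormal (f : M → ℝ) (p : M) : TangentSpace (𝓡 m) p :=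
  (-(g.lapseInv f p)⁻¹) • g.grad f p

/-- The divergence `∇_μ X^μ` of a vector field. -/
def divergence (X : ∀ p : M, TangentSpace (𝓡 m) p) (p : M) : ℝ :=
  let z := extChartAt (𝓡 m) p p
  ∑ i : Fin m, (fderiv ℝ (vectorCoord X p) z (stdVec i)
    + g.christoffel p z (stdVec i) (vectorCoord X p z)) i

/-- The mean curvature at `p` of the level set of `f` through `p`, with respect to the unit normal
that points to increasing values of `f`: the divergence of the normal field. -/
def levelMeanCurvature (f : M → ℝ) (p : M) : ℝ := g.divergence (g.levelNormal f) p

/-- `S` is a Cauchy surface of the open set `U`, regarded as a spacetime of its own: every timelike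
curve in `U` without end points in `U` meets `S` exactly once. -/
def IsCauchySurfaceIn (U S : Set M) : Prop :=
  S ⊆ U ∧ ∀ γ : ℝ → M, ContMDiff 𝓘(ℝ, ℝ) (𝓡 m) 1 γ → (∀ s, γ s ∈ U) →
    (∀ s, g.inner (γ s) (mfderiv 𝓘(ℝ, ℝ) (𝓡 m) γ s (1 : ℝ))
      (mfderiv 𝓘(ℝ, ℝ) (𝓡 m) γ s (1 : ℝ)) < 0) →
    (¬ ∃ p ∈ U, Tendsto γ atTop (𝓝 p)) → (¬ ∃ p ∈ U, Tendsto γ atBot (𝓝 p)) →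
    ∃! s, γ s ∈ S

end LorentzMetric

end Manifold

/-! ### Immersed spacelike hypersurfaces -/

section Hypersurface

variable {n : ℕ} {M : Type*} [TopologicalSpace M] [ChartedSpace (Coord (n + 1)) M]
  [IsManifold (𝓡 (n + 1)) ∞ M] (g : LorentzMetric (n + 1) M)
  {S : Type*} [TopologicalSpace S] [ChartedSpace (Coord n) S]

/-- The first fundamental form at `x` of a map `y` of an `n`-manifold into the spacetime. -/
def firstForm (y : S → M) (x : S) (u v : TangentSpace (𝓡 n) x) : ℝ :=
  g.inner (y x) (mfderiv (𝓡 n) (𝓡 (n + 1)) y x u) (mfderiv (𝓡 n) (𝓡 (n + 1)) y x v)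

/-- `y` is a spacelike immersion at `x`: the induced metric is positive definite. -/
def IsSpacelikeAt (y : S → M) (x : S) : Prop :=
  ∀ u : TangentSpace (𝓡 n) x, u ≠ 0 → 0 < firstForm g y x u u

/-- The covariant second derivative `∇_u (dy v)` of `y` at `x`, in the preferred charts at `x`
and at `y x`. -/
def covHessian (y : S → M) (x : S) (u v : Coord n) : Coord (n + 1) :=
  let Y : Coord n → Coord (n + 1) := writtenInExtChartAt (𝓡 n) (𝓡 (n + 1)) x y
  let a : Coord n := extChartAt (𝓡 n) x x
  fderiv ℝ (fderiv ℝ Y) a u v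
    + g.christoffel (y x) (extChartAt (𝓡 (n + 1)) (y x) (y x)) (fderiv ℝ Y a u) (fderiv ℝ Y a v)

/-- The second fundamental form `K(u, v) = g(∇_u ν, v) = -g(ν, ∇_u (dy v))` at `x`, for the unit
normal `ν`. -/
def secondForm (y : S → M) (x : S) (ν : TangentSpace (𝓡 (n + 1)) (y x)) (u v : Coord n) : ℝ :=
  -(g.inner (y x) ν (covHessian g y x u v))

/-- The mean curvature `K = h^{ij} K_{ij}` at `x`, for the unit normal `ν`. -/
def meanCurvature (y : S → M) (x : S) (ν : TangentSpace (𝓡 (n + 1)) (y x)) : ℝ :=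
  let h : Matrix (Fin n) (Fin n) ℝ :=
    Matrix.of fun i j ↦ firstForm g y x (stdVec i : Coord n) (stdVec j : Coord n)
  ∑ i : Fin n, ∑ j : Fin n, h⁻¹ i j * secondForm g y x ν (stdVec i) (stdVec j)

end Hypersurface

/-! ### Cosmologies -/

/-- A cosmology of dimension `n + 1` with a fixed smooth time function `t` and an initial time
`t₀`. The time orientation is the one for which `t` increases to the future. The slices
`{t = s}`, `s ≥ t₀`, are compact Cauchy surfaces, and the initial slice `{t = t₀}` is expanding
everywhere. -/
structure Cosmology (n : ℕ) (M : Type*) [TopologicalSpace M] [ChartedSpace (Coord (n + 1)) M]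
    [IsManifold (𝓡 (n + 1)) ∞ M] where
  /-- the spacetime metric -/
  g : LorentzMetric (n + 1) M
  /-- the time function -/
  t : M → ℝ
  /-- the initial time -/
  t₀ : ℝ
  t_smooth : ContMDiff (𝓡 (n + 1)) 𝓘(ℝ, ℝ) ∞ t
  t_temporal : ∀ p, g.inner p (g.grad t p) (g.grad t p) < 0
  slice_cauchy : ∀ s, t₀ ≤ s → g.IsCauchySurfaceIn univ {p | t p = s}
  slice_compact : ∀ s, t₀ ≤ s → IsCompact {p | t p = s}
  expanding : ∀ p, t p = t₀ → 0 < g.levelMeanCurvature t p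

namespace Cosmology

variable {n : ℕ} {M : Type*} [TopologicalSpace M] [ChartedSpace (Coord (n + 1)) M]
  [IsManifold (𝓡 (n + 1)) ∞ M] (X : Cosmology n M)

/-- The part of the spacetime foliated by the slices with `t ∈ [t₀, ∞)`. -/
def region : Set M := {p | X.t₀ ≤ X.t p}

/-- Future-directed timelike vectors. -/
def IsFutureTimelike (p : M) (k : TangentSpace (𝓡 (n + 1)) p) : Prop :=
  X.g.inner p k k < 0 ∧ 0 < differential X.t p k

/-- The inverse lapse `N⁻¹` of the foliation by the level sets of `t`. -/
def lapseInv (p : M) : ℝ := X.g.lapseInv X.t p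

/-- The stress-energy tensor of the matter other than the cosmological constant, as determined by
the Einstein equations `Ric - R g / 2 = 8 π G (T - Λ g)`. -/
def stress (G Λ : ℝ) (p : M) (v w : TangentSpace (𝓡 (n + 1)) p) : ℝ :=
  (8 * Real.pi * G)⁻¹ * (X.g.ricci p v w - X.g.scalar p / 2 * X.g.inner p v w)
    + Λ * X.g.inner p v w

/-- The dominant energy condition: for every future-directed timelike `k`, the vector
`w^μ = -T^μ_ν k^ν` is future-directed and timelike or null (possibly zero). -/
def DominantEnergy (G Λ : ℝ) : Prop :=
  ∀ p ∈ X.region, ∀ k : TangentSpace (𝓡 (n + 1)) p, X.IsFutureTimelike p k →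
    ∀ w : TangentSpace (𝓡 (n + 1)) p, (∀ v, X.g.inner p w v = -(X.stress G Λ p v k)) →
      X.g.inner p w w ≤ 0 ∧ 0 ≤ differential X.t p w

/-- The strong energy condition `(T_{μν} - g_{μν} T / (n - 1)) k^μ k^ν ≥ 0` for every
future-directed timelike `k`. -/
def StrongEnergy (G Λ : ℝ) : Prop :=
  ∀ p ∈ X.region, ∀ k : TangentSpace (𝓡 (n + 1)) p, X.IsFutureTimelike p k →
    0 ≤ X.stress G Λ p k k
      - X.g.inner p k k * X.g.traceForm p (X.stress G Λ p) / ((n : ℝ) - 1)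

/-- The cosmology has potential singularities only of the crushing kind, as witnessed by the open
set `𝒩`, the function `τ` and the constant `c₀`. On `𝒩 ∩ {τ > c₀}` (which may be empty)
`τ` is a Cauchy time function whose level sets `{τ = c}` have mean curvature `< -c`, and the
inverse lapse of `t` is bounded outside `𝒩` and on each set `{τ ≤ c}`. -/
structure CrushingOnly (𝒩 : Set M) (τ : M → ℝ) (c₀ : ℝ) : Prop where
  isOpen : IsOpen 𝒩
  contains_slice : ∃ S ⊆ 𝒩, X.g.IsCauchySurfaceIn univ S
  c₀_nonneg : 0 ≤ c₀
  isOpen_inter : IsOpen (𝒩 ∩ {p | c₀ < τ p})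
  smooth : ContMDiffOn (𝓡 (n + 1)) 𝓘(ℝ, ℝ) ∞ τ (𝒩 ∩ {p | c₀ < τ p})
  temporal : ∀ p ∈ 𝒩 ∩ {p | c₀ < τ p}, X.g.inner p (X.g.grad τ p) (X.g.grad τ p) < 0
  future : ∀ p ∈ 𝒩 ∩ {p | c₀ < τ p}, 0 < differential X.t p (X.g.levelNormal τ p)
  range_eq : (𝒩 ∩ {p | c₀ < τ p}).Nonempty → τ '' (𝒩 ∩ {p | c₀ < τ p}) = Ioi c₀
  cauchy : ∀ c, c₀ < c →
    X.g.IsCauchySurfaceIn (𝒩 ∩ {p | c₀ < τ p}) (𝒩 ∩ {p | τ p = c})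
  crushing : ∀ p ∈ 𝒩 ∩ {p | c₀ < τ p}, X.g.levelMeanCurvature τ p < -τ p
  bounded_outside : BddAbove (X.lapseInv '' (X.region \ 𝒩))
  bounded_below_level : ∀ c, BddAbove (X.lapseInv '' (X.region ∩ {p | τ p ≤ c}))

/-! ### Mean curvature flow -/

variable {S : Type*} [TopologicalSpace S] [ChartedSpace (Coord n) S]

/-- The future-directed unit normal of `y` at `x` (it exists and is unique if `y` is a spacelike
immersion at `x`). -/
def futureNormal (y : S → M) (x : S) : TangentSpace (𝓡 (n + 1)) (y x) :=
  Classical.epsilon fun ν ↦ X.g.inner (y x) ν ν = -1 ∧ 0 < differential X.t (y x) ν ∧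
    ∀ u : TangentSpace (𝓡 n) x, X.g.inner (y x) ν (mfderiv (𝓡 n) (𝓡 (n + 1)) y x u) = 0

/-- The mean curvature `K` of `y` at `x` with respect to the future-directed unit normal. -/
def hypersurfaceK (y : S → M) (x : S) : ℝ := meanCurvature X.g y x (X.futureNormal y x)

/-- `y lam`, for `0 ≤ lam < lam₀`, is a smooth family of spacelike immersions of `S` into the
spacetime region `t ≥ t₀` that solves the mean curvature flow `dy/dlam = K ν`. -/
structure IsMeanCurvatureFlow (y : ℝ → S → M) (lam₀ : ℝ) : Prop where
  mapsTo : ∀ lam ∈ Ico 0 lam₀, ∀ x, y lam x ∈ X.region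
  smooth : ContMDiffOn ((𝓡 n).prod 𝓘(ℝ, ℝ)) (𝓡 (n + 1)) ∞
    (fun z : S × ℝ ↦ y z.2 z.1) (univ ×ˢ Ico 0 lam₀)
  spacelike : ∀ lam ∈ Ico 0 lam₀, ∀ x, IsSpacelikeAt X.g (y lam) x
  flow : ∀ lam ∈ Ico 0 lam₀, ∀ x,
    HasMFDerivWithinAt 𝓘(ℝ, ℝ) (𝓡 (n + 1)) (fun s ↦ y s x) (Ico 0 lam₀) lam
      (ContinuousLinearMap.toSpanSingleton ℝ
        (X.hypersurfaceK (y lam) x • X.futureNormal (y lam) x))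

end Cosmology

/-- `K_Λ`, with `K_Λ² = (n / (n - 1)) 16 π G Λ`. -/
def KLam (n : ℕ) (G Λ : ℝ) : ℝ := √((n : ℝ) / ((n : ℝ) - 1) * (16 * Real.pi * G * Λ))

end CosmologyFlow

end

/-! The height is controlled by two maximum principles. At a spatial maximum of `u` the hypersurface
is tangent to a level set of `t`, so the two share their future normal, `dt(n) = N⁻¹`, and `u` grows
at the rate `K N⁻¹`. The flow stays in `{τ < c}`, where `N⁻¹` is at most its supremum `A`; once `K ≤
B` with `B ≥ 0`, the height therefore grows at most at the rate `A B` (`height_le`). The bound at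
the final parameter follows by passing to the limit.

The bound on `K` comes from `∂K = ΔK - K (|k|² + Ric(n, n))`, with `k` the second fundamental form.
The strong energy condition and the Einstein equations give `Ric(n, n) ≥ -16πGΛ/(n-1)`
(`ricci_lower_bound`), and Cauchy-Schwarz gives `|k|² ≥ K²/n`. So `K` strictly decreases at any
spatial maximum where it exceeds `K_Λ`, and `K ≤ max (sup K₀) K_Λ` along the flow
(`hypersurfaceK_le`). This dictates `C(A, B) = max A 0 * max B K_Λ`.

The evolution equation is needed only at spatial maxima of `K`. There the gradient of `K` vanishes,
which makes the normal parallel in time and coordinate second derivatives as good as covariant ones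
(`hasDerivAt_speed_neg_of_isLocalMax`).

Two points need care. The normal is obtained by choice, so the regularity of `K` is recovered from
the velocity: `K² = -g(∂y, ∂y)`, and `K` has the sign of `∂u`. This gives continuity everywhere, and
where `K > 0` it gives smooth formulas for `K` and `n`, which is enough because `K_Λ ≥ 0`. Moreover,
the second fundamental form is defined in the preferred chart at the moving point `y x`; the
transformation law of the Christoffel symbols brings it into one fixed chart before time derivatives
are taken. Curvature is evaluated only at the centre of its own chart. -/

noncomputable section

namespace CosmologyFlow

set_option synthInstance.maxHeartbeats 400000
set_option linter.unusedSectionVars false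

/-! ### Levi-Civita calculus along maps into a coordinate space -/

section FlatCalculus

variable {E F : Type} [NormedAddCommGroup E] [NormedSpace ℝ E]
  [NormedAddCommGroup F] [NormedSpace ℝ F]

instance : NormedAddCommGroup (F →L[ℝ] ℝ) := ContinuousLinearMap.toNormedAddCommGroup

instance : NormedSpace ℝ (F →L[ℝ] ℝ) := ContinuousLinearMap.toNormedSpace

instance : NormedAddCommGroup (F →L[ℝ] F →L[ℝ] ℝ) := ContinuousLinearMap.toNormedAddCommGroup

instance : NormedSpace ℝ (F →L[ℝ] F →L[ℝ] ℝ) := ContinuousLinearMap.toNormedSpace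

instance : NormedAddCommGroup (F →L[ℝ] F →L[ℝ] F →L[ℝ] ℝ) :=
  @ContinuousLinearMap.toNormedAddCommGroup ℝ ℝ F (F →L[ℝ] F →L[ℝ] ℝ) _ _ _ _ _ _ (RingHom.id ℝ) _

instance : NormedSpace ℝ (F →L[ℝ] F →L[ℝ] F →L[ℝ] ℝ) :=
  @ContinuousLinearMap.toNormedSpace ℝ ℝ F (F →L[ℝ] F →L[ℝ] ℝ) _ _ _ _ _ _ (RingHom.id ℝ) _ ℝ _ _ _

instance : NormedAddCommGroup (F →L[ℝ] F) := ContinuousLinearMap.toNormedAddCommGroup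

instance : NormedSpace ℝ (F →L[ℝ] F) := ContinuousLinearMap.toNormedSpace

instance : NormedAddCommGroup (F →L[ℝ] F →L[ℝ] F) := ContinuousLinearMap.toNormedAddCommGroup

instance : NormedSpace ℝ (F →L[ℝ] F →L[ℝ] F) := ContinuousLinearMap.toNormedSpace

/-- The Koszul form `(∂_v g(w, u) + ∂_w g(v, u) - ∂_u g(v, w)) / 2` of a derivative of a metric. -/
def koszul (dg : F →L[ℝ] F →L[ℝ] F →L[ℝ] ℝ) : F →L[ℝ] F →L[ℝ] F →L[ℝ] ℝ :=
  (1 / 2 : ℝ) • (dg + dg.flip -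
    ((ContinuousLinearMap.flipₗᵢ ℝ F F ℝ).toContinuousLinearEquiv :
      (F →L[ℝ] F →L[ℝ] ℝ) →L[ℝ] (F →L[ℝ] F →L[ℝ] ℝ)) ∘L dg.flip)

theorem koszul_apply (dg : F →L[ℝ] F →L[ℝ] F →L[ℝ] ℝ) (v w : F) :
    koszul dg v w = (1 / 2 : ℝ) • (dg v w + dg w v - (dg.flip v).flip w) := by
  ext u
  simp [koszul]

/-- The Christoffel symbols of a metric on a vector space, as a bilinear map. -/
def christoffelMap (G : F → F →L[ℝ] F →L[ℝ] ℝ) (z : F) : F →L[ℝ] F →L[ℝ] F :=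
  (ContinuousLinearMap.compL ℝ F (F →L[ℝ] ℝ) F (G z).inverse) ∘L koszul (fderiv ℝ G z)

theorem christoffelMap_apply (G : F → F →L[ℝ] F →L[ℝ] ℝ) (z v w : F) :
    christoffelMap G z v w = (G z).inverse ((1 / 2 : ℝ) • (fderiv ℝ G z v w + fderiv ℝ G z w v
      - ((fderiv ℝ G z).flip v).flip w)) := by
  simp only [christoffelMap, ContinuousLinearMap.comp_apply, ContinuousLinearMap.compL_apply,
    koszul_apply]

theorem contDiffAt_koszul [CompleteSpace F] {G : F → F →L[ℝ] F →L[ℝ] ℝ} {z : F} {n m : ℕ∞ω}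
    (hG : ContDiffAt ℝ n G z) (hmn : m + 1 ≤ n) :
    ContDiffAt ℝ m (fun z ↦ koszul (fderiv ℝ G z)) z := by
  have h := hG.fderiv_right hmn
  have h' : ContDiffAt ℝ m (fun z ↦ (fderiv ℝ G z).flip) z :=
    (ContinuousLinearMap.flipₗᵢ ℝ F F (F →L[ℝ] ℝ)).contDiff.contDiffAt.comp z h
  unfold koszul
  exact ((h.add h').sub (contDiffAt_const.clm_comp h')).const_smul _

theorem contDiffAt_christoffelMap [CompleteSpace F] {G : F → F →L[ℝ] F →L[ℝ] ℝ} {z : F}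
    {n m : ℕ∞ω} (hG : ContDiffAt ℝ n G z) (hi : (G z).IsInvertible) (hmn : m + 1 ≤ n) :
    ContDiffAt ℝ m (christoffelMap G) z := by
  have h1 : ContDiffAt ℝ m (fun z ↦ (G z).inverse) z :=
    ContDiffAt.comp z (hi.contDiffAt_map_inverse) (hG.of_le (le_trans le_self_add hmn))
  have h2 := (ContinuousLinearMap.compL ℝ F (F →L[ℝ] ℝ) F).contDiff.contDiffAt.comp z h1
  exact h2.clm_comp (contDiffAt_koszul hG hmn)

/-- Lowering the index removes the inverse metric and leaves the Koszul formula; metric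
compatibility and the change-of-chart law are both checked in this form. -/
theorem inner_christoffelMap {G : F → F →L[ℝ] F →L[ℝ] ℝ} {z : F}
    (hi : (G z).IsInvertible) (v w u : F) :
    G z (christoffelMap G z v w) u = (1 / 2 : ℝ) * (fderiv ℝ G z v w u + fderiv ℝ G z w v u
      - fderiv ℝ G z u v w) := by
  rw [christoffelMap_apply, hi.self_apply_inverse]
  simp

theorem fderiv_metric_symm {G : F → F →L[ℝ] F →L[ℝ] ℝ} {z : F} (hd : DifferentiableAt ℝ G z)
    (hs : ∀ᶠ z' in 𝓝 z, ∀ v w, G z' v w = G z' w v) (u v w : F) :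
    fderiv ℝ G z u v w = fderiv ℝ G z u w v := by
  have key : ∀ a b : F, fderiv ℝ (fun z ↦ G z a b) z u = fderiv ℝ G z u a b := fun a b ↦ by
    rw [fderiv_clm_apply (hd.clm_apply (differentiableAt_const a)) (differentiableAt_const b),
      fderiv_clm_apply hd (differentiableAt_const a)]
    simp
  rw [← key, ← key, Filter.EventuallyEq.fderiv_eq]
  filter_upwards [hs] with z' h using h v w

theorem christoffelMap_symm {G : F → F →L[ℝ] F →L[ℝ] ℝ} {z : F} (hd : DifferentiableAt ℝ G z)
    (hs : ∀ᶠ z' in 𝓝 z, ∀ v w, G z' v w = G z' w v) (v w : F) :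
    christoffelMap G z v w = christoffelMap G z w v := by
  rw [christoffelMap_apply, christoffelMap_apply]
  congr 2
  ext u
  simp only [sub_apply, add_apply,
    ContinuousLinearMap.flip_apply]
  rw [fderiv_metric_symm hd hs u v w]
  ring

/-- Metric compatibility: in the sum of the two Koszul expressions only the terms differentiated in
the direction `u` survive. -/
theorem fderiv_metric_eq_christoffelMap {G : F → F →L[ℝ] F →L[ℝ] ℝ} {z : F}
    (hd : DifferentiableAt ℝ G z)
    (hs : ∀ᶠ z' in 𝓝 z, ∀ v w, G z' v w = G z' w v) (hi : (G z).IsInvertible) (u v w : F) :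
    fderiv ℝ G z u v w = G z (christoffelMap G z u v) w + G z v (christoffelMap G z u w) := by
  rw [hs.self_of_nhds v, inner_christoffelMap hi, inner_christoffelMap hi,
    fderiv_metric_symm hd hs u w v]
  ring

/-- The covariant derivative in the direction `u` of a vector field `V` along the map `Y`. -/
def cov (G : F → F →L[ℝ] F →L[ℝ] ℝ) (Y V : E → F) (u x : E) : F :=
  fderiv ℝ V x u + christoffelMap G (Y x) (fderiv ℝ Y x u) (V x)

/-- The curvature operator `R(a, b) w` of a metric on a vector space. -/
def curv (G : F → F →L[ℝ] F →L[ℝ] ℝ) (z a b w : F) : F :=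
  fderiv ℝ (christoffelMap G) z a b w - fderiv ℝ (christoffelMap G) z b a w
    + christoffelMap G z a (christoffelMap G z b w)
    - christoffelMap G z b (christoffelMap G z a w)

theorem curv_smul_left (G : F → F →L[ℝ] F →L[ℝ] ℝ) (z a b w : F) (c : ℝ) :
    curv G z (c • a) b w = c • curv G z a b w := by
  simp only [curv, map_smul, smul_apply, smul_sub, smul_add]

theorem curv_swap (G : F → F →L[ℝ] F →L[ℝ] ℝ) (z a b w : F) :
    curv G z a b w = -curv G z b a w := by
  simp only [curv]; abel

variable {G : F → F →L[ℝ] F →L[ℝ] ℝ} {Y : E → F} {x : E}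

theorem cov_congr {V W : E → F} (h : V =ᶠ[𝓝 x] W) (u : E) : cov G Y V u x = cov G Y W u x := by
  rw [cov, cov, h.fderiv_eq, h.self_of_nhds]

theorem cov_smul {f : E → ℝ} {V : E → F} (hf : DifferentiableAt ℝ f x)
    (hV : DifferentiableAt ℝ V x) (u : E) :
    cov G Y (fun x ↦ f x • V x) u x = fderiv ℝ f x u • V x + f x • cov G Y V u x := by
  rw [cov, cov, fderiv_fun_smul hf hV]
  simp only [add_apply, smul_apply, map_smul,
    ContinuousLinearMap.smulRight_apply, smul_add]
  abel

theorem fderiv_metric_fields (hY : DifferentiableAt ℝ Y x) (hd : DifferentiableAt ℝ G (Y x))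
    {V W : E → F} (hV : DifferentiableAt ℝ V x) (hW : DifferentiableAt ℝ W x) (u : E) :
    fderiv ℝ (fun x ↦ G (Y x) (V x) (W x)) x u
      = fderiv ℝ G (Y x) (fderiv ℝ Y x u) (V x) (W x)
        + G (Y x) (fderiv ℝ V x u) (W x) + G (Y x) (V x) (fderiv ℝ W x u) := by
  have hGY : DifferentiableAt ℝ (fun x ↦ G (Y x)) x := hd.comp x hY
  have h1 : fderiv ℝ (fun x ↦ G (Y x)) x u = fderiv ℝ G (Y x) (fderiv ℝ Y x u) := by
    rw [show (fun x ↦ G (Y x)) = G ∘ Y from rfl, fderiv_comp x hd hY]; rfl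
  rw [fderiv_clm_apply (hGY.clm_apply hV) hW, fderiv_clm_apply hGY hV]
  simp only [add_apply, ContinuousLinearMap.comp_apply, ContinuousLinearMap.flip_apply, h1]
  abel

/-- The Christoffel terms of `cov` absorb exactly the derivative of the metric coefficients along
`Y`. -/
theorem fderiv_inner_fields (hY : DifferentiableAt ℝ Y x) (hd : DifferentiableAt ℝ G (Y x))
    (hs : ∀ᶠ z in 𝓝 (Y x), ∀ v w, G z v w = G z w v) (hi : (G (Y x)).IsInvertible)
    {V W : E → F} (hV : DifferentiableAt ℝ V x) (hW : DifferentiableAt ℝ W x) (u : E) :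
    fderiv ℝ (fun x ↦ G (Y x) (V x) (W x)) x u
      = G (Y x) (cov G Y V u x) (W x) + G (Y x) (V x) (cov G Y W u x) := by
  rw [fderiv_metric_fields hY hd hV hW, fderiv_metric_eq_christoffelMap hd hs hi]
  simp only [cov, map_add, add_apply]
  abel

theorem fderiv_fderiv_apply {H : Type} [NormedAddCommGroup H] [NormedSpace ℝ H] {V : E → H}
    (hV : DifferentiableAt ℝ (fderiv ℝ V) x) (u v : E) :
    fderiv ℝ (fun x ↦ fderiv ℝ V x v) x u = fderiv ℝ (fderiv ℝ V) x u v := by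
  rw [fderiv_clm_apply hV (differentiableAt_const v)]; simp

theorem fderiv_fderiv_comm {H : Type} [NormedAddCommGroup H] [NormedSpace ℝ H] {V : E → H}
    (hV : ContDiffAt ℝ 2 V x) (u v : E) :
    fderiv ℝ (fderiv ℝ V) x u v = fderiv ℝ (fderiv ℝ V) x v u :=
  (hV.isSymmSndFDerivAt (by simp)).eq u v

theorem differentiableAt_fderiv {H : Type} [NormedAddCommGroup H] [NormedSpace ℝ H] {V : E → H}
    (hV : ContDiffAt ℝ 2 V x) : DifferentiableAt ℝ (fderiv ℝ V) x :=
  (hV.fderiv_right (m := 1) le_rfl).differentiableAt one_ne_zero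

/-- Torsion-freeness, pulled back along `Y`: both the second derivative of `Y` and the Christoffel
symbols are symmetric. -/
theorem cov_fderiv_comm (hY : ContDiffAt ℝ 2 Y x) (hd : DifferentiableAt ℝ G (Y x))
    (hs : ∀ᶠ z in 𝓝 (Y x), ∀ v w, G z v w = G z w v) (u v : E) :
    cov G Y (fun x ↦ fderiv ℝ Y x v) u x = cov G Y (fun x ↦ fderiv ℝ Y x u) v x := by
  have h := differentiableAt_fderiv hY
  rw [cov, cov, christoffelMap_symm hd hs, fderiv_fderiv_apply h, fderiv_fderiv_apply h,
    fderiv_fderiv_comm hY]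

theorem fderiv_christoffel_fields (hY : DifferentiableAt ℝ Y x)
    (hΓ : DifferentiableAt ℝ (christoffelMap G) (Y x))
    {V W : E → F} (hV : DifferentiableAt ℝ V x) (hW : DifferentiableAt ℝ W x) (u : E) :
    fderiv ℝ (fun x ↦ christoffelMap G (Y x) (V x) (W x)) x u
      = fderiv ℝ (christoffelMap G) (Y x) (fderiv ℝ Y x u) (V x) (W x)
        + christoffelMap G (Y x) (fderiv ℝ V x u) (W x)
        + christoffelMap G (Y x) (V x) (fderiv ℝ W x u) := by
  have hGY : DifferentiableAt ℝ (fun x ↦ christoffelMap G (Y x)) x := hΓ.comp x hY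
  have h1 : fderiv ℝ (fun x ↦ christoffelMap G (Y x)) x u
      = fderiv ℝ (christoffelMap G) (Y x) (fderiv ℝ Y x u) := by
    rw [show (fun x ↦ christoffelMap G (Y x)) = christoffelMap G ∘ Y from rfl,
      fderiv_comp x hΓ hY]; rfl
  rw [fderiv_clm_apply (hGY.clm_apply hV) hW, fderiv_clm_apply hGY hV]
  simp only [add_apply, ContinuousLinearMap.comp_apply,
    ContinuousLinearMap.flip_apply, h1]
  abel

theorem differentiableAt_christoffel_fields (hY : DifferentiableAt ℝ Y x)
    (hΓ : DifferentiableAt ℝ (christoffelMap G) (Y x))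
    {V W : E → F} (hV : DifferentiableAt ℝ V x) (hW : DifferentiableAt ℝ W x) :
    DifferentiableAt ℝ (fun x ↦ christoffelMap G (Y x) (V x) (W x)) x := by
  have hGY : DifferentiableAt ℝ (fun x ↦ christoffelMap G (Y x)) x := hΓ.comp x hY
  exact (hGY.clm_apply hV).clm_apply hW

theorem differentiableAt_cov (hY : ContDiffAt ℝ 2 Y x)
    (hΓ : DifferentiableAt ℝ (christoffelMap G) (Y x))
    {V : E → F} (hV : ContDiffAt ℝ 2 V x) (u : E) :
    DifferentiableAt ℝ (cov G Y V u) x :=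
  ((differentiableAt_fderiv hV).clm_apply (differentiableAt_const u)).add
    (differentiableAt_christoffel_fields (hY.differentiableAt two_ne_zero) hΓ
      ((differentiableAt_fderiv hY).clm_apply (differentiableAt_const u))
      (hV.differentiableAt two_ne_zero))

/-- The Ricci identity: covariant derivatives along a map commute up to curvature. -/
theorem cov_cov_comm (hY : ContDiffAt ℝ 2 Y x)
    (hΓ : DifferentiableAt ℝ (christoffelMap G) (Y x))
    {V : E → F} (hV : ContDiffAt ℝ 2 V x) (u v : E) :
    cov G Y (cov G Y V v) u x = cov G Y (cov G Y V u) v x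
      + curv G (Y x) (fderiv ℝ Y x u) (fderiv ℝ Y x v) (V x) := by
  have hY1 := hY.differentiableAt two_ne_zero
  have hV1 := hV.differentiableAt two_ne_zero
  have hdY := differentiableAt_fderiv hY
  have hdV := differentiableAt_fderiv hV
  -- In this expansion everything except the derivative of `Γ` and the quadratic term in `Γ` is
  -- symmetric in `u` and `v`; the antisymmetric remainder is the curvature.
  have key : ∀ u v : E, cov G Y (cov G Y V v) u x =
      fderiv ℝ (fderiv ℝ V) x u v
        + (fderiv ℝ (christoffelMap G) (Y x) (fderiv ℝ Y x u) (fderiv ℝ Y x v) (V x)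
          + christoffelMap G (Y x) (fderiv ℝ (fderiv ℝ Y) x u v) (V x)
          + christoffelMap G (Y x) (fderiv ℝ Y x v) (fderiv ℝ V x u))
        + christoffelMap G (Y x) (fderiv ℝ Y x u)
          (fderiv ℝ V x v + christoffelMap G (Y x) (fderiv ℝ Y x v) (V x)) := fun u v ↦ by
    rw [cov]
    congr 1
    unfold cov
    rw [fderiv_fun_add (hdV.clm_apply (differentiableAt_const v))
      (differentiableAt_christoffel_fields hY1 hΓ (hdY.clm_apply (differentiableAt_const v)) hV1),
      add_apply, fderiv_fderiv_apply hdV,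
      fderiv_christoffel_fields hY1 hΓ (hdY.clm_apply (differentiableAt_const v)) hV1,
      fderiv_fderiv_apply hdY]
  rw [key u v, key v u, fderiv_fderiv_comm hV u v, fderiv_fderiv_comm hY u v, curv]
  simp only [map_add]
  abel

end FlatCalculus

/-! ### Variation formulas for a map moving along its unit normal -/

section NormalFlow

variable {E F : Type} [NormedAddCommGroup E] [NormedSpace ℝ E]
  [NormedAddCommGroup F] [NormedSpace ℝ F] [CompleteSpace F]

/-- Near `x`, the map `Y` moves in the direction `l` with speed `k` along a field `N` of timelike
unit vectors that are orthogonal to the derivatives of `Y` in the directions in `P`. -/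
structure NormalFlowAt (G : F → F →L[ℝ] F →L[ℝ] ℝ) (Y N : E → F) (k : E → ℝ) (P : Set E) (l x : E) :
    Prop where
  smooth : ContDiffAt ℝ 3 Y x
  smooth_normal : ContDiffAt ℝ 2 N x
  smooth_speed : ContDiffAt ℝ 2 k x
  smooth_metric : ContDiffAt ℝ 3 G (Y x)
  symm : ∀ᶠ z in 𝓝 (Y x), ∀ v w, G z v w = G z w v
  invertible : (G (Y x)).IsInvertible
  unit : ∀ᶠ z in 𝓝 x, G (Y z) (N z) (N z) = -1
  normal : ∀ᶠ z in 𝓝 x, ∀ u ∈ P, G (Y z) (N z) (fderiv ℝ Y z u) = 0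
  flow : ∀ᶠ z in 𝓝 x, fderiv ℝ Y z l = k z • N z

theorem eventually_isInvertible {G : F → F →L[ℝ] F →L[ℝ] ℝ} {z : F} (hG : ContinuousAt G z)
    (hi : (G z).IsInvertible) : ∀ᶠ z' in 𝓝 z, (G z').IsInvertible := by
  obtain ⟨e, he⟩ := hi
  have := ContinuousLinearEquiv.nhds e
  rw [he] at this
  filter_upwards [hG this] with z' ⟨e', he'⟩
  exact ⟨e', he'⟩

namespace NormalFlowAt

variable {G : F → F →L[ℝ] F →L[ℝ] ℝ} {Y N : E → F} {k : E → ℝ} {P : Set E} {l x : E}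

/-- All the conditions are open, so an identity proved at the point holds nearby and may itself be
differentiated. -/
theorem eventually (h : NormalFlowAt G Y N k P l x) :
    ∀ᶠ x' in 𝓝 x, NormalFlowAt G Y N k P l x' := by
  have hc : ContinuousAt Y x := h.smooth.continuousAt
  filter_upwards [h.smooth.eventually (by simp), h.smooth_normal.eventually (by simp),
    h.smooth_speed.eventually (by simp), hc.eventually (h.smooth_metric.eventually (by simp)),
    hc.eventually h.symm.eventually_nhds,
    hc.eventually (eventually_isInvertible h.smooth_metric.continuousAt h.invertible),
    h.unit.eventually_nhds, h.normal.eventually_nhds, h.flow.eventually_nhds]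
    with x' h1 h2 h3 h4 h5 h6 h7 h8 h9
  exact ⟨h1, h2, h3, h4, h5, h6, h7, h8, h9⟩

section
variable (h : NormalFlowAt G Y N k P l x)
include h

theorem contDiffAt_two : ContDiffAt ℝ 2 Y x := h.smooth.of_le (by norm_num)

theorem differentiableAt : DifferentiableAt ℝ Y x := h.smooth.differentiableAt (by simp)

theorem differentiableAt_metric : DifferentiableAt ℝ G (Y x) :=
  h.smooth_metric.differentiableAt (by simp)

theorem differentiableAt_normal : DifferentiableAt ℝ N x :=
  h.smooth_normal.differentiableAt (by simp)

theorem differentiableAt_speed : DifferentiableAt ℝ k x :=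
  h.smooth_speed.differentiableAt (by simp)

theorem differentiableAt_partial (u : E) : DifferentiableAt ℝ (fun z ↦ fderiv ℝ Y z u) x :=
  (differentiableAt_fderiv h.contDiffAt_two).clm_apply (differentiableAt_const u)

theorem differentiableAt_christoffel : DifferentiableAt ℝ (christoffelMap G) (Y x) :=
  (contDiffAt_christoffelMap (m := 1) h.smooth_metric h.invertible
    (by norm_num)).differentiableAt one_ne_zero

theorem differentiableAt_cov_normal (u : E) : DifferentiableAt ℝ (cov G Y N u) x :=
  differentiableAt_cov h.contDiffAt_two h.differentiableAt_christoffel h.smooth_normal u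

theorem fderiv_inner {V W : E → F} (hV : DifferentiableAt ℝ V x) (hW : DifferentiableAt ℝ W x)
    (u : E) : fderiv ℝ (fun x ↦ G (Y x) (V x) (W x)) x u
      = G (Y x) (cov G Y V u x) (W x) + G (Y x) (V x) (cov G Y W u x) :=
  fderiv_inner_fields h.differentiableAt h.differentiableAt_metric h.symm h.invertible hV hW u

theorem inner_comm (v w : F) : G (Y x) v w = G (Y x) w v := h.symm.self_of_nhds v w

theorem inner_cov_normal_normal (e : E) : G (Y x) (cov G Y N e x) (N x) = 0 := by
  have h1 := h.fderiv_inner h.differentiableAt_normal h.differentiableAt_normal e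
  have h2 : (fun z ↦ G (Y z) (N z) (N z)) =ᶠ[𝓝 x] fun _ ↦ -1 := h.unit
  rw [h2.fderiv_eq, h.inner_comm (N x)] at h1
  simp only [fderiv_const_apply, zero_apply] at h1
  linarith

/-- Weingarten's relation: differentiating `g(N, ∂_u Y) = 0` trades second derivatives of `Y` for
first derivatives of `N`. -/
theorem inner_normal_cov_partial {u : E} (hu : u ∈ P) (e : E) :
    G (Y x) (N x) (cov G Y (fun z ↦ fderiv ℝ Y z u) e x)
      = -G (Y x) (cov G Y N e x) (fderiv ℝ Y x u) := by
  have h1 := h.fderiv_inner h.differentiableAt_normal (h.differentiableAt_partial u) e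
  have h2 : (fun z ↦ G (Y z) (N z) (fderiv ℝ Y z u)) =ᶠ[𝓝 x] fun _ ↦ 0 := by
    filter_upwards [h.normal] with z hz using hz u hu
  rw [h2.fderiv_eq] at h1
  simp only [fderiv_const_apply, zero_apply] at h1
  linarith

/-- By torsion-freeness `∇_l ∂_u Y = ∇_u ∂_l Y`, and `∂_l Y = k N`. -/
theorem cov_partial_flow (u : E) :
    cov G Y (fun z ↦ fderiv ℝ Y z u) l x = fderiv ℝ k x u • N x + k x • cov G Y N u x := by
  rw [← cov_smul h.differentiableAt_speed h.differentiableAt_normal,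
    cov_fderiv_comm h.contDiffAt_two h.differentiableAt_metric h.symm]
  exact cov_congr h.flow u

theorem inner_cov_normal_symm {u v : E} (hu : u ∈ P) (hv : v ∈ P) :
    G (Y x) (cov G Y N u x) (fderiv ℝ Y x v) = G (Y x) (cov G Y N v x) (fderiv ℝ Y x u) := by
  rw [← neg_inj, ← h.inner_normal_cov_partial hv, ← h.inner_normal_cov_partial hu,
    cov_fderiv_comm h.contDiffAt_two h.differentiableAt_metric h.symm]

/-- The first variation of the induced metric. -/
theorem fderiv_firstForm {u v : E} (hu : u ∈ P) (hv : v ∈ P) :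
    fderiv ℝ (fun z ↦ G (Y z) (fderiv ℝ Y z u) (fderiv ℝ Y z v)) x l
      = 2 * k x * G (Y x) (cov G Y N u x) (fderiv ℝ Y x v) := by
  have hn := h.normal.self_of_nhds
  rw [h.fderiv_inner (h.differentiableAt_partial u) (h.differentiableAt_partial v),
    h.cov_partial_flow, h.cov_partial_flow, h.inner_comm (fderiv ℝ Y x u)]
  simp only [map_add, map_smul, add_apply, smul_apply, smul_eq_mul, hn u hu, hn v hv,
    h.inner_cov_normal_symm hv hu]
  ring

/-- The normal turns with the gradient of the speed; the sign is positive because `g(N, N) = -1`. -/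
theorem inner_cov_normal_flow {u : E} (hu : u ∈ P) :
    G (Y x) (cov G Y N l x) (fderiv ℝ Y x u) = fderiv ℝ k x u := by
  rw [← neg_inj, ← h.inner_normal_cov_partial hu, h.cov_partial_flow]
  simp only [map_add, map_smul, smul_eq_mul, h.unit.self_of_nhds,
    h.inner_comm (N x) (cov G Y N u x), h.inner_cov_normal_normal]
  ring

/-- The first variation of the second fundamental form at a critical point of the speed. -/
theorem fderiv_secondForm {u v : E} (hv : v ∈ P) (hcrit : fderiv ℝ k x v = 0)
    (hN : cov G Y N l x = 0) :
    fderiv ℝ (fun z ↦ -G (Y z) (N z) (cov G Y (fun z ↦ fderiv ℝ Y z v) u z)) x l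
      = fderiv ℝ (fun z ↦ fderiv ℝ k z v) x u
        + k x * G (Y x) (curv G (Y x) (N x) (fderiv ℝ Y x u) (N x)) (fderiv ℝ Y x v)
        + k x * G (Y x) (cov G Y N u x) (cov G Y N v x) := by
  -- In Weingarten form only a first derivative of `N` appears, so the time derivative needs no more
  -- than the Ricci identity for `N`.
  have h1 : (fun z ↦ -G (Y z) (N z) (cov G Y (fun z ↦ fderiv ℝ Y z v) u z)) =ᶠ[𝓝 x]
      fun z ↦ G (Y z) (cov G Y N u z) (fderiv ℝ Y z v) := by
    filter_upwards [h.eventually] with z hz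
    rw [hz.inner_normal_cov_partial hv, neg_neg]
  -- The term `g(∇_u ∇_l N, ∂_v Y)` is found by differentiating `g(∇_l N, ∂_v Y) = ∂_v k` in the
  -- direction `u`; the other term of the product rule vanishes because `∇_l N = 0` at `x`.
  have h2 : (fun z ↦ G (Y z) (cov G Y N l z) (fderiv ℝ Y z v)) =ᶠ[𝓝 x]
      fun z ↦ fderiv ℝ k z v := by
    filter_upwards [h.eventually] with z hz using hz.inner_cov_normal_flow hv
  have h3 := h.fderiv_inner (h.differentiableAt_cov_normal l) (h.differentiableAt_partial v) u
  rw [h2.fderiv_eq, hN, map_zero, zero_apply, add_zero] at h3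
  rw [h1.fderiv_eq, h.fderiv_inner (h.differentiableAt_cov_normal u) (h.differentiableAt_partial v),
    cov_cov_comm h.contDiffAt_two h.differentiableAt_christoffel h.smooth_normal,
    h.cov_partial_flow, hcrit, h.flow.self_of_nhds, curv_smul_left, h3]
  simp only [map_add, map_smul, add_apply, smul_apply, smul_eq_mul, zero_smul, zero_add]

end

end NormalFlowAt

end NormalFlow

/-! ### Traces of one bilinear form with respect to another -/

section Trace

section
attribute [local instance] Matrix.linftyOpNormedRing Matrix.linftyOpNormedAlgebra

/-- Inversion has derivative `B ↦ -A⁻¹ B A⁻¹` at `A`; at the identity only the sign remains. -/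
theorem hasDerivAt_matrix_inv_apply {n : ℕ} {A : ℝ → Matrix (Fin n) (Fin n) ℝ}
    {A' : Matrix (Fin n) (Fin n) ℝ} {s₀ : ℝ}
    (hA : ∀ i j, HasDerivAt (fun s ↦ A s i j) (A' i j) s₀) (h1 : A s₀ = 1) (i j : Fin n) :
    HasDerivAt (fun s ↦ (A s)⁻¹ i j) (-A' i j) s₀ := by
  have hd : HasDerivAt A A' s₀ := by
    have : HasDerivAt (fun s ↦ ∑ i, ∑ j, A s i j • Matrix.single i j (1 : ℝ))
        (∑ i, ∑ j, A' i j • Matrix.single i j (1 : ℝ)) s₀ :=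
      HasDerivAt.fun_sum fun i _ ↦ HasDerivAt.fun_sum fun j _ ↦ (hA i j).smul_const _
    simp only [Matrix.smul_single, smul_eq_mul, mul_one, ← Matrix.matrix_eq_sum_single] at this
    exact this
  have hinv : HasFDerivAt Ring.inverse (-ContinuousLinearMap.mulLeftRight ℝ
      (Matrix (Fin n) (Fin n) ℝ) ↑(1 : (Matrix (Fin n) (Fin n) ℝ)ˣ)⁻¹
        ↑(1 : (Matrix (Fin n) (Fin n) ℝ)ˣ)⁻¹) (A s₀) := by
    rw [h1]
    exact hasFDerivAt_ringInverse (1 : (Matrix (Fin n) (Fin n) ℝ)ˣ)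
  have h2 := hinv.comp_hasDerivAt s₀ hd
  simp only [inv_one, Units.val_one, neg_apply, ContinuousLinearMap.mulLeftRight_apply, one_mul,
    mul_one] at h2
  have h3 := ((LinearMap.toContinuousLinearMap
    (Matrix.entryLinearMap ℝ ℝ i j)).hasFDerivAt).comp_hasDerivAt s₀ h2
  refine (h3.congr_of_eventuallyEq (Eventually.of_forall fun s ↦ ?_))
  simp [Matrix.nonsing_inv_eq_ringInverse]

end

theorem bilin_expand {m : ℕ} (h : Coord m →L[ℝ] Coord m →L[ℝ] ℝ) (u v : Coord m) :
    h u v = ∑ i, ∑ j, u i * v j * h (stdVec i) (stdVec j) := by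
  have e : ∀ u : Coord m, u = ∑ i, u i • stdVec i := fun u ↦ by
    have := (EuclideanSpace.basisFun (Fin m) ℝ).sum_repr u
    simpa [stdVec] using this.symm
  conv_lhs => rw [e u, e v]
  simp only [map_sum, map_smul, sum_apply, smul_apply, smul_eq_mul,
    Finset.mul_sum]
  rw [Finset.sum_comm]
  refine Finset.sum_congr rfl fun i _ ↦ Finset.sum_congr rfl fun j _ ↦ by ring

/-- The first variation of the trace of one bilinear form with respect to another, in a frame that
is orthonormal at the base time. -/
theorem hasDerivAt_trace_form {n : ℕ} {h b : ℝ → Coord n →L[ℝ] Coord n →L[ℝ] ℝ} {s₀ : ℝ}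
    {f : Fin n → Coord n} {h' b' : Fin n → Fin n → ℝ}
    (hf : ∀ i j, h s₀ (f i) (f j) = if i = j then 1 else 0)
    (hh : ∀ i j, HasDerivAt (fun s ↦ h s (f i) (f j)) (h' i j) s₀)
    (hb : ∀ i j, HasDerivAt (fun s ↦ b s (f i) (f j)) (b' i j) s₀) :
    HasDerivAt (fun s ↦ ∑ i, ∑ j, (Matrix.of fun i j ↦ h s (stdVec i) (stdVec j))⁻¹ i j
      * b s (stdVec i) (stdVec j))
      (∑ i, b' i i - ∑ i, ∑ j, h' i j * b s₀ (f i) (f j)) s₀ := by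
  -- The columns of `P` are the frame vectors and `Q c` is the matrix of `c` in the frame. The trace
  -- of `h⁻¹ b` is the same in both bases, and in the frame the matrix of `h` is the identity at
  -- `s₀`.
  let P : Matrix (Fin n) (Fin n) ℝ := Matrix.of fun i j ↦ f j i
  let M : (Coord n →L[ℝ] Coord n →L[ℝ] ℝ) → Matrix (Fin n) (Fin n) ℝ :=
    fun c ↦ Matrix.of fun i j ↦ c (stdVec i) (stdVec j)
  let Q : (Coord n →L[ℝ] Coord n →L[ℝ] ℝ) → Matrix (Fin n) (Fin n) ℝ :=
    fun c ↦ Matrix.of fun i j ↦ c (f i) (f j)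
  have hQ : ∀ c, Q c = P.transpose * M c * P := fun c ↦ by
    ext i j
    simp only [Q, P, M, Matrix.of_apply, Matrix.mul_apply, Matrix.transpose_apply]
    rw [bilin_expand c (f i) (f j), Finset.sum_comm]
    refine Finset.sum_congr rfl fun k _ ↦ ?_
    rw [Finset.sum_mul]
    refine Finset.sum_congr rfl fun l _ ↦ by ring
  have hQ1 : Q (h s₀) = 1 := by
    ext i j
    simp [Q, hf, Matrix.one_apply]
  have hP : IsUnit P.det := by
    have := congrArg Matrix.det hQ1
    rw [hQ, Matrix.det_mul, Matrix.det_one] at this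
    exact IsUnit.of_mul_eq_one _ (by rw [mul_comm]; exact this)
  have hPt : IsUnit P.transpose.det := by rwa [Matrix.det_transpose]
  have key : ∀ c d : Coord n →L[ℝ] Coord n →L[ℝ] ℝ,
      ∑ i, ∑ j, (M c)⁻¹ i j * M d i j = ∑ i, ∑ j, (Q c)⁻¹ i j * Q d i j := fun c d ↦ by
    have tr : ∀ A B : Matrix (Fin n) (Fin n) ℝ,
        ∑ i, ∑ j, A i j * B i j = (A * B.transpose).trace := fun A B ↦ by
      simp [Matrix.trace, Matrix.mul_apply]
    rw [tr, tr, hQ, hQ, Matrix.mul_inv_rev, Matrix.mul_inv_rev, Matrix.transpose_mul,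
      Matrix.transpose_mul, Matrix.transpose_transpose]
    rw [show P⁻¹ * ((M c)⁻¹ * P.transpose⁻¹) * (P.transpose * ((M d).transpose * P))
      = P⁻¹ * ((M c)⁻¹ * (P.transpose⁻¹ * P.transpose) * (M d).transpose * P) by
        simp only [Matrix.mul_assoc], Matrix.nonsing_inv_mul _ hPt, Matrix.mul_one,
        Matrix.trace_mul_comm P⁻¹, Matrix.mul_assoc, Matrix.mul_nonsing_inv _ hP, Matrix.mul_one]
  have h2 : HasDerivAt (fun s ↦ ∑ i, ∑ j, (Q (h s))⁻¹ i j * Q (b s) i j)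
      (∑ i, ∑ j, (-(h' i j) * Q (b s₀) i j + (Q (h s₀))⁻¹ i j * b' i j)) s₀ := by
    refine HasDerivAt.fun_sum fun i _ ↦ HasDerivAt.fun_sum fun j _ ↦ ?_
    exact (hasDerivAt_matrix_inv_apply (A := fun s ↦ Q (h s)) (A' := Matrix.of h')
      (fun i j ↦ hh i j) hQ1 i j).mul (hb i j)
  have h3 := h2.congr_of_eventuallyEq (Eventually.of_forall fun s ↦ key (h s) (b s))
  refine h3.congr_deriv ?_
  rw [hQ1]
  simp only [inv_one, Matrix.one_apply, ite_mul, one_mul, zero_mul, Finset.sum_add_distrib,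
    Finset.sum_ite_eq, Finset.mem_univ, if_true, neg_mul, Finset.sum_neg_distrib]
  simp only [Q, Matrix.of_apply]
  ring

/-- The trace of one bilinear form with respect to another is the sum of the diagonal entries in an
orthonormal frame. -/
theorem trace_form_eq_sum {n : ℕ} {h b : Coord n →L[ℝ] Coord n →L[ℝ] ℝ}
    {f : Fin n → Coord n} (hf : ∀ i j, h (f i) (f j) = if i = j then 1 else 0) :
    ∑ i, ∑ j, (Matrix.of fun i j ↦ h (stdVec i) (stdVec j))⁻¹ i j * b (stdVec i) (stdVec j)
      = ∑ i, b (f i) (f i) := by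
  -- The trace is linear in `b`, hence equal to the derivative at `0` of the trace of `s • b`; the
  -- variation formula with constant `h` computes that derivative.
  have h1 : ∀ i j, HasDerivAt (fun s : ℝ ↦ (s • b) (f i) (f j)) (b (f i) (f j)) 0 := fun i j ↦ by
    simpa using (hasDerivAt_id (0 : ℝ)).mul_const (b (f i) (f j))
  have h2 := hasDerivAt_trace_form (h := fun _ ↦ h) (b := fun s ↦ s • b) (s₀ := 0) hf
    (h' := fun _ _ ↦ 0) (fun i j ↦ hasDerivAt_const _ _) h1
  have h3 : HasDerivAt (fun s : ℝ ↦ s * ∑ i, ∑ j, (Matrix.of fun i j ↦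
      h (stdVec i) (stdVec j))⁻¹ i j * b (stdVec i) (stdVec j)) (1 * ∑ i, ∑ j, (Matrix.of fun i j ↦
      h (stdVec i) (stdVec j))⁻¹ i j * b (stdVec i) (stdVec j)) 0 :=
    (hasDerivAt_id (0 : ℝ)).mul_const _
  rw [← one_mul (∑ i, ∑ j, _)]
  refine h3.unique ?_
  refine (h2.congr_of_eventuallyEq (Eventually.of_forall fun s ↦ ?_)).congr_deriv (by simp)
  simp only [Finset.mul_sum, smul_apply, smul_eq_mul]
  refine Finset.sum_congr rfl fun i _ ↦ Finset.sum_congr rfl fun j _ ↦ by ring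

/-- A positive definite form has an orthonormal frame. -/
theorem exists_orthonormal_frame {n : ℕ} (h : Coord n →L[ℝ] Coord n →L[ℝ] ℝ)
    (hs : ∀ u v, h u v = h v u) (hp : ∀ u, u ≠ 0 → 0 < h u u) :
    ∃ f : Fin n → Coord n, ∀ i j, h (f i) (f j) = if i = j then 1 else 0 := by
  let B : LinearMap.BilinForm ℝ (Coord n) :=
    LinearMap.mk₂ ℝ (fun u v ↦ h u v) (by simp) (by simp) (by simp) (by simp)
  have hB : LinearMap.IsSymm B := ⟨fun u v ↦ hs u v⟩
  obtain ⟨v, hv⟩ := LinearMap.BilinForm.exists_orthogonal_basis hB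
  have hn : Module.finrank ℝ (Coord n) = n := by simp
  let w := v.reindex (finCongr hn)
  have hw : ∀ i j, i ≠ j → h (w i) (w j) = 0 := fun i j hij ↦ by
    have := hv (i := (finCongr hn).symm i) (j := (finCongr hn).symm j) (by simpa using hij)
    simpa [w, B, Function.onFun] using this
  refine ⟨fun i ↦ (√(h (w i) (w i)))⁻¹ • w i, fun i j ↦ ?_⟩
  simp only [map_smul, smul_apply, smul_eq_mul]
  split_ifs with hij
  · subst hij
    have h0 := hp (w i) (w.ne_zero i)
    have h1 := Real.mul_self_sqrt h0.le
    have h2 : √(h (w i) (w i)) ≠ 0 := (Real.sqrt_pos.mpr h0).ne'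
    field_simp
    nlinarith
  · rw [hw i j hij]; simp

end Trace

/-! ### Orthonormal frames of a Lorentzian scalar product -/

section Frames

variable {n : ℕ} {g : Coord (n + 1) →L[ℝ] Coord (n + 1) →L[ℝ] ℝ} {e : Fin n → Coord (n + 1)}
  {ν : Coord (n + 1)}

/-- `e` and `ν` form an orthonormal frame of a Lorentzian scalar product. -/
structure IsLorentzFrame (g : Coord (n + 1) →L[ℝ] Coord (n + 1) →L[ℝ] ℝ)
    (e : Fin n → Coord (n + 1)) (ν : Coord (n + 1)) : Prop where
  symm : ∀ v w, g v w = g w v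
  ortho : ∀ i j, g (e i) (e j) = if i = j then 1 else 0
  normal : ∀ i, g ν (e i) = 0
  unit : g ν ν = -1

namespace IsLorentzFrame

variable (h : IsLorentzFrame g e ν)
include h

/-- The frame as a basis. -/
theorem exists_basis : ∃ b : Module.Basis (Option (Fin n)) ℝ (Coord (n + 1)),
    b none = ν ∧ ∀ i, b (some i) = e i := by
  let v : Option (Fin n) → Coord (n + 1) := fun o ↦ o.elim ν e
  have hli : LinearIndependent ℝ v := by
    rw [Fintype.linearIndependent_iff]
    intro c hc
    rw [Fintype.sum_option] at hc
    have hν := congrArg (fun w ↦ g ν w) hc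
    have he : ∀ i, _ := fun i ↦ congrArg (fun w ↦ g (e i) w) hc
    simp only [v, Option.elim, map_add, map_sum, map_smul, h.unit, h.normal, smul_eq_mul,
      map_zero, h.ortho, h.symm _ ν, mul_zero, Finset.sum_const_zero, add_zero, zero_add,
      mul_ite, mul_one, Finset.sum_ite_eq, Finset.mem_univ, if_true] at hν he
    intro o
    cases o with
    | none => linarith
    | some i => exact he i
  refine ⟨basisOfLinearIndependentOfCardEqFinrank hli (by simp), ?_, fun i ↦ ?_⟩ <;> simp [v]

theorem expand (v : Coord (n + 1)) : v = ∑ i, g v (e i) • e i - g v ν • ν := by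
  obtain ⟨b, hbν, hbe⟩ := h.exists_basis
  have hv := b.sum_repr v
  rw [Fintype.sum_option, hbν] at hv
  simp only [hbe] at hv
  have h1 : g v ν = -(b.repr v none) := by
    have := congrArg (fun w ↦ g ν w) hv
    simp only [map_add, map_sum, map_smul, h.unit, h.normal, smul_eq_mul, mul_zero,
      Finset.sum_const_zero] at this
    rw [h.symm]
    linarith
  have h2 : ∀ i, g v (e i) = b.repr v (some i) := fun i ↦ by
    have := congrArg (fun w ↦ g (e i) w) hv
    simp only [map_add, map_sum, map_smul, h.symm (e i) ν, h.normal, smul_eq_mul, mul_zero,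
      h.ortho, mul_ite, mul_one, Finset.sum_ite_eq, Finset.mem_univ, if_true] at this
    rw [h.symm]
    linarith
  simp only [h1, h2]
  rw [neg_smul, sub_neg_eq_add, add_comm (∑ i, _)]
  exact hv.symm

/-- The trace is independent of the basis, which lets the Ricci tensor, defined as a coordinate
trace, be computed in an adapted frame; the `ν` term is negative because `g(ν, ν) = -1`. -/
theorem trace_eq (L : Coord (n + 1) →ₗ[ℝ] Coord (n + 1)) :
    ∑ i, (L (stdVec i)) i = ∑ j, g (L (e j)) (e j) - g (L ν) ν := by
  obtain ⟨b, hbν, hbe⟩ := h.exists_basis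
  have h1 : LinearMap.trace ℝ _ L = ∑ i, (L (stdVec i)) i := by
    rw [LinearMap.trace_eq_matrix_trace ℝ (EuclideanSpace.basisFun (Fin (n + 1)) ℝ).toBasis]
    simp [Matrix.trace, LinearMap.toMatrix_apply, stdVec]
  rw [← h1, LinearMap.trace_eq_matrix_trace ℝ b, Matrix.trace, Fintype.sum_option]
  have hr : ∀ v, b.repr v none = -g v ν ∧ ∀ i, b.repr v (some i) = g v (e i) := fun v ↦ by
    have hv : v = b.equivFun.symm (fun o ↦ o.elim (-g v ν) fun i ↦ g v (e i)) := by
      rw [Module.Basis.equivFun_symm_apply, Fintype.sum_option, hbν]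
      simp only [hbe, Option.elim]
      rw [neg_smul, neg_add_eq_sub, ← h.expand v]
    have h3 := congrArg b.equivFun hv
    rw [LinearEquiv.apply_symm_apply] at h3
    exact ⟨congrFun h3 none, fun i ↦ congrFun h3 (some i)⟩
  simp only [Matrix.diag_apply, LinearMap.toMatrix_apply, (hr _).1, (hr _).2, hbν, hbe]
  ring

/-- For tangential vectors such as `∇_u N` this turns the scalar product into a sum without negative
terms, so that `|k|²` appears as a sum of squares. -/
theorem inner_eq_sum {v w : Coord (n + 1)} (hv : g v ν = 0) :
    g v w = ∑ i, g v (e i) * g w (e i) := by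
  conv_lhs => rw [h.expand v, hv]
  simp [h.symm (e _) w]

end IsLorentzFrame

end Frames

/-! ### Linear algebra of Lorentzian forms -/

section Lorentz

variable {V : Type} [NormedAddCommGroup V] [NormedSpace ℝ V]

/-- A symmetric bilinear form of signature `(-, +, …, +)`. -/
structure IsLorentzForm (g : V →L[ℝ] V →L[ℝ] ℝ) : Prop where
  symm : ∀ v w, g v w = g w v
  signature : ∃ v, g v v < 0 ∧ ∀ w, g v w = 0 → w ≠ 0 → 0 < g w w

namespace IsLorentzForm

variable {g : V →L[ℝ] V →L[ℝ] ℝ} (h : IsLorentzForm g)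
include h

/-- The signature provides a single timelike `v` with positive complement. If `w` were not
spacelike, the combination of `T` and `w` orthogonal to `v` would be a nonzero vector of that
complement with nonpositive square. -/
theorem pos_of_orthogonal_timelike {T w : V} (hT : g T T < 0) (hw : g T w = 0) (h0 : w ≠ 0) :
    0 < g w w := by
  obtain ⟨v, hv, hpos⟩ := h.signature
  have hT0 : T ≠ 0 := by rintro rfl; simp at hT
  by_contra hle
  push Not at hle
  have hvT : g v T ≠ 0 := fun hvT ↦ absurd (hpos T hvT hT0) (by linarith)
  set x := g v w • T - g v T • w with hx
  have hvx : g v x = 0 := by simp [hx]; ring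
  have hTx : g T x = g v w * g T T := by simp [hx, hw]
  have hxx : g x x = g v w ^ 2 * g T T + g v T ^ 2 * g w w := by
    simp [hx, hw, h.symm w T]; ring
  have hx0 : x ≠ 0 := fun hx0 ↦ by
    rw [hx0, map_zero] at hTx
    have hvw : g v w = 0 := by
      rcases mul_eq_zero.mp hTx.symm with h1 | h1
      · exact h1
      · exact absurd h1 hT.ne
    rw [hx0, hvw, zero_smul, zero_sub] at hx
    exact (smul_ne_zero hvT h0) (neg_eq_zero.mp hx.symm)
  have := hpos x hvx hx0
  nlinarith [sq_nonneg (g v w), sq_nonneg (g v T), mul_nonneg (sq_nonneg (g v w)) (neg_nonneg.mpr hT.le),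
    mul_nonneg (sq_nonneg (g v T)) (neg_nonneg.mpr hle)]

theorem eq_zero_of_inner_eq_zero {v : V} (hv : ∀ w, g v w = 0) : v = 0 := by
  obtain ⟨T, hT, hpos⟩ := h.signature
  by_contra h0
  exact absurd (hpos v (by rw [h.symm, hv]) h0) (by rw [hv]; exact lt_irrefl _)

theorem isInvertible [FiniteDimensional ℝ V] : g.IsInvertible := by
  have hinj : Function.Injective (g : V →ₗ[ℝ] (V →L[ℝ] ℝ)) := by
    rw [injective_iff_map_eq_zero]
    intro v hv
    exact h.eq_zero_of_inner_eq_zero fun w ↦ by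
      have : g v = 0 := hv
      rw [this]; rfl
  have hfin : Module.finrank ℝ V = Module.finrank ℝ (V →L[ℝ] ℝ) := by
    rw [← (LinearMap.toContinuousLinearMap (𝕜 := ℝ) (E := V) (F' := ℝ)).finrank_eq]
    exact (Subspace.dual_finrank_eq).symm
  refine ⟨(LinearEquiv.ofInjectiveOfFinrankEq (g : V →ₗ[ℝ] (V →L[ℝ] ℝ)) hinj
    hfin).toContinuousLinearEquiv, ?_⟩
  ext v w
  rfl

variable {U : Type} [NormedAddCommGroup U] [NormedSpace ℝ U] [FiniteDimensional ℝ U]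
  [FiniteDimensional ℝ V] {A : U →L[ℝ] V}

/-- If `Z` were not timelike, the range of `A` and `Z` would span `V` by dimension, and the form
would be nonnegative on all of `V`. -/
theorem timelike_of_orthogonal_spacelike
    (hdim : Module.finrank ℝ V = Module.finrank ℝ U + 1)
    (hA : ∀ u, u ≠ 0 → 0 < g (A u) (A u)) {Z : V} (hZ : ∀ u, g Z (A u) = 0) (h0 : Z ≠ 0) :
    g Z Z < 0 := by
  by_contra hle
  push Not at hle
  let L : U × ℝ →ₗ[ℝ] V := (A : U →ₗ[ℝ] V).coprod (LinearMap.toSpanSingleton ℝ V Z)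
  have hL : ∀ u c, L (u, c) = A u + c • Z := fun u c ↦ by simp [L]
  have hinj : Function.Injective L := by
    rw [injective_iff_map_eq_zero]
    rintro ⟨u, c⟩ huc
    rw [hL] at huc
    have h1 : g (A u) (A u) = 0 := by
      have := congrArg (fun w ↦ g w (A u)) huc
      simpa [hZ] using this
    have hu : u = 0 := by
      by_contra hu
      exact absurd (hA u hu) (by rw [h1]; exact lt_irrefl _)
    rw [hu, map_zero, zero_add] at huc
    have hc : c = 0 := (smul_eq_zero.mp huc).resolve_right h0
    rw [hu, hc]; rfl
  have hsurj : Function.Surjective L :=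
    (LinearMap.injective_iff_surjective_of_finrank_eq_finrank (by simp [hdim])).mp hinj
  obtain ⟨v, hv, -⟩ := h.signature
  obtain ⟨⟨u, c⟩, huc⟩ := hsurj v
  rw [hL] at huc
  have hvv : g v v = g (A u) (A u) + c ^ 2 * g Z Z := by
    rw [← huc]
    simp [hZ, h.symm (A u) Z]; ring
  have hAu : 0 ≤ g (A u) (A u) := by
    by_cases hu : u = 0
    · simp [hu]
    · exact (hA u hu).le
  nlinarith [mul_nonneg (sq_nonneg c) hle]

theorem eq_zero_of_orthogonal
    (hdim : Module.finrank ℝ V = Module.finrank ℝ U + 1)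
    (hA : ∀ u, u ≠ 0 → 0 < g (A u) (A u)) {T Z : V} (hT : g T T < 0) (hTZ : g T Z = 0)
    (hZ : ∀ u, g Z (A u) = 0) : Z = 0 := by
  by_contra h0
  exact absurd (h.timelike_of_orthogonal_spacelike hdim hA hZ h0)
    (h.pos_of_orthogonal_timelike hT hTZ h0).not_gt

/-- By dimension some nonzero vector is orthogonal to the range of `A`. It is timelike and not
orthogonal to `T`, so it can be normalized and its sign chosen. -/
theorem exists_normal
    (hdim : Module.finrank ℝ V = Module.finrank ℝ U + 1)
    (hA : ∀ u, u ≠ 0 → 0 < g (A u) (A u)) {T : V} (hT : g T T < 0) :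
    ∃ ν, g ν ν = -1 ∧ 0 < g T ν ∧ ∀ u, g ν (A u) = 0 := by
  let L : V →ₗ[ℝ] Module.Dual ℝ U := LinearMap.mk₂ ℝ (fun v u ↦ g v (A u)) (by simp) (by simp)
    (by simp) (by simp)
  have hker : LinearMap.ker L ≠ ⊥ := LinearMap.ker_ne_bot_of_finrank_lt (by
    rw [Subspace.dual_finrank_eq, hdim]; omega)
  obtain ⟨Z, hZ, h0⟩ := (Submodule.ne_bot_iff _).mp hker
  have hZA : ∀ u, g Z (A u) = 0 := fun u ↦ LinearMap.congr_fun (LinearMap.mem_ker.mp hZ) u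
  have hZZ := h.timelike_of_orthogonal_spacelike hdim hA hZA h0
  have hTZ : g T Z ≠ 0 := fun hTZ ↦ h0 (h.eq_zero_of_orthogonal hdim hA hT hTZ hZA)
  have hs : 0 < √(-g Z Z) := Real.sqrt_pos.mpr (by linarith)
  have hsq : √(-g Z Z) ^ 2 = -g Z Z := Real.sq_sqrt (by linarith)
  have hc : ∀ c : ℝ, c ^ 2 = 1 → g ((c / √(-g Z Z)) • Z) ((c / √(-g Z Z)) • Z) = -1 := fun c hc ↦ by
    simp only [map_smul, smul_apply, smul_eq_mul]
    field_simp
    rw [hsq, hc]; ring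
  rcases lt_or_gt_of_ne hTZ with hlt | hgt
  · refine ⟨((-1) / √(-g Z Z)) • Z, hc (-1) (by norm_num), ?_, fun u ↦ by simp [hZA]⟩
    simp only [map_smul, smul_eq_mul]
    exact mul_pos_of_neg_of_neg (div_neg_of_neg_of_pos (by norm_num) hs) hlt
  · refine ⟨(1 / √(-g Z Z)) • Z, hc 1 (by norm_num), ?_, fun u ↦ by simp [hZA]⟩
    simp only [map_smul, smul_eq_mul]
    positivity

/-- At a point where the gradient `T` is normal to the spacelike hypersurface, the unit normal `ν`
satisfies `g(T, ν)² = -g(T, T)`. -/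
theorem inner_normal_of_gradient_normal
    (hdim : Module.finrank ℝ V = Module.finrank ℝ U + 1)
    (hA : ∀ u, u ≠ 0 → 0 < g (A u) (A u)) {T ν : V} (hT : g T T < 0) (hTA : ∀ u, g T (A u) = 0)
    (hν : g ν ν = -1) (hTν : 0 < g T ν) (hνA : ∀ u, g ν (A u) = 0) :
    g T ν = √(-g T T) := by
  -- The component of `ν` orthogonal to `T` is orthogonal to the hypersurface as well, so it
  -- vanishes and `ν` is a multiple of `T`.
  have hZ : ν - (g T ν / g T T) • T = 0 :=
    h.eq_zero_of_orthogonal hdim hA hT (by simp [hT.ne]) (fun u ↦ by simp [hTA, hνA])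
  rw [sub_eq_zero] at hZ
  have h1 : g ν ν = g T ν ^ 2 / g T T := by
    conv_lhs => rw [hZ]
    simp only [map_smul, smul_apply, smul_eq_mul]
    field_simp [hT.ne]
  rw [hν, eq_div_iff hT.ne] at h1
  rw [eq_comm, Real.sqrt_eq_iff_mul_self_eq (by linarith) hTν.le]
  linarith

end IsLorentzForm

end Lorentz

/-! ### The metric in the preferred charts -/

section Charts

variable {m : ℕ} {M : Type*} [TopologicalSpace M] [ChartedSpace (Coord m) M]

variable [IsManifold (𝓡 m) ∞ M]

theorem mdifferentiableAt_extChartAt_symm {q : M} {z : Coord m}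
    (hz : z ∈ (extChartAt (𝓡 m) q).target) :
    MDifferentiableAt 𝓘(ℝ, Coord m) (𝓡 m) (extChartAt (𝓡 m) q).symm z := by
  have := mdifferentiableWithinAt_extChartAt_symm (I := 𝓡 m) hz
  rwa [ModelWithCorners.range_eq_univ, mdifferentiableWithinAt_univ] at this

/-- The differential of the preferred chart at `q`. -/
def chartDeriv (q p : M) : Coord m →L[ℝ] Coord m :=
  mfderiv (𝓡 m) 𝓘(ℝ, Coord m) (extChartAt (𝓡 m) q) p

/-- The differential of the inverse of the preferred chart at `q`. -/
def chartSymmDeriv (q : M) (z : Coord m) : Coord m →L[ℝ] Coord m :=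
  mfderivWithin 𝓘(ℝ, Coord m) (𝓡 m) (extChartAt (𝓡 m) q).symm (range (𝓡 m)) z

theorem chartSymmDeriv_eq_mfderiv (q : M) (z : Coord m) :
    chartSymmDeriv q z = mfderiv 𝓘(ℝ, Coord m) (𝓡 m) (extChartAt (𝓡 m) q).symm z := by
  rw [chartSymmDeriv, ModelWithCorners.range_eq_univ, mfderivWithin_univ]

theorem chartDeriv_chartSymmDeriv {q : M} {z : Coord m}
    (hz : z ∈ (extChartAt (𝓡 m) q).target) (v : Coord m) :
    chartDeriv q ((extChartAt (𝓡 m) q).symm z) (chartSymmDeriv q z v) = v :=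
  DFunLike.congr_fun (mfderiv_extChartAt_comp_mfderivWithin_extChartAt_symm (I := 𝓡 m) hz) v

theorem chartSymmDeriv_chartDeriv {q p : M} (hp : p ∈ (extChartAt (𝓡 m) q).source) (v : Coord m) :
    chartSymmDeriv q (extChartAt (𝓡 m) q p) (chartDeriv q p v) = v :=
  DFunLike.congr_fun (mfderivWithin_extChartAt_symm_comp_mfderiv_extChartAt' (I := 𝓡 m) hp) v

theorem chartDeriv_self (p : M) : chartDeriv p p = ContinuousLinearMap.id ℝ (Coord m) :=
  mfderiv_extChartAt_self (I := 𝓡 m)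

theorem chartSymmDeriv_self (p : M) :
    chartSymmDeriv p (extChartAt (𝓡 m) p p) = ContinuousLinearMap.id ℝ (Coord m) :=
  mfderivWithin_range_extChartAt_symm (I := 𝓡 m)

/-- The transition map between two preferred charts. -/
def chartTransition (q p : M) (z : Coord m) : Coord m :=
  extChartAt (𝓡 m) p ((extChartAt (𝓡 m) q).symm z)

theorem contDiffAt_chartTransition {q p : M} {z : Coord m}
    (hz : z ∈ (extChartAt (𝓡 m) q).target)
    (hp : (extChartAt (𝓡 m) q).symm z ∈ (extChartAt (𝓡 m) p).source) :
    ContDiffAt ℝ ∞ (chartTransition q p) z := by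
  rw [← contMDiffAt_iff_contDiffAt]
  have h1 : ContMDiffAt 𝓘(ℝ, Coord m) (𝓡 m) ∞ (extChartAt (𝓡 m) q).symm z :=
    (contMDiffOn_extChartAt_symm q).contMDiffAt ((isOpen_extChartAt_target q).mem_nhds hz)
  have h2 : ContMDiffAt (𝓡 m) 𝓘(ℝ, Coord m) ∞ (extChartAt (𝓡 m) p)
      ((extChartAt (𝓡 m) q).symm z) := contMDiffAt_extChartAt' (by simpa using hp)
  exact h2.comp z h1

theorem fderiv_chartTransition {q p : M} {z : Coord m}
    (hz : z ∈ (extChartAt (𝓡 m) q).target)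
    (hp : (extChartAt (𝓡 m) q).symm z ∈ (extChartAt (𝓡 m) p).source) (v : Coord m) :
    fderiv ℝ (chartTransition q p) z v
      = chartDeriv p ((extChartAt (𝓡 m) q).symm z) (chartSymmDeriv q z v) := by
  have h2 : MDifferentiableAt (𝓡 m) 𝓘(ℝ, Coord m) (extChartAt (𝓡 m) p)
      ((extChartAt (𝓡 m) q).symm z) := mdifferentiableAt_extChartAt (by simpa using hp)
  have := mfderiv_comp z h2 (mdifferentiableAt_extChartAt_symm hz)
  rw [mfderiv_eq_fderiv] at this
  rw [chartSymmDeriv_eq_mfderiv]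
  exact DFunLike.congr_fun this v

namespace LorentzMetric

variable (g : LorentzMetric m M)

/-- The scalar product at `p`, as a form on the model space. -/
def form (p : M) : Coord m →L[ℝ] Coord m →L[ℝ] ℝ := g.inner p

theorem isLorentzForm (p : M) : IsLorentzForm (g.form p) :=
  ⟨g.symm p, g.signature p⟩

theorem coord_apply (q : M) (z v w : Coord m) :
    g.coord q z v w = g.form ((extChartAt (𝓡 m) q).symm z) (chartSymmDeriv q z v)
      (chartSymmDeriv q z w) := rfl

theorem coord_chartDeriv {q p : M} (hp : p ∈ (extChartAt (𝓡 m) q).source) (v w : Coord m) :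
    g.coord q (extChartAt (𝓡 m) q p) (chartDeriv q p v) (chartDeriv q p w) = g.form p v w := by
  rw [coord_apply, chartSymmDeriv_chartDeriv hp, chartSymmDeriv_chartDeriv hp,
    (extChartAt (𝓡 m) q).left_inv hp]

theorem coord_self (p : M) (v w : Coord m) :
    g.coord p (extChartAt (𝓡 m) p p) v w = g.form p v w := by
  have := g.coord_chartDeriv (mem_extChartAt_source (I := 𝓡 m) p) v w
  rwa [chartDeriv_self] at this

theorem coord_symm (q : M) (z v w : Coord m) : g.coord q z v w = g.coord q z w v := by
  rw [coord_apply, coord_apply, (g.isLorentzForm _).symm]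

theorem isLorentzForm_coord {q : M} {z : Coord m} (hz : z ∈ (extChartAt (𝓡 m) q).target) :
    IsLorentzForm (g.coord q z) := by
  refine ⟨g.coord_symm q z, ?_⟩
  set p := (extChartAt (𝓡 m) q).symm z with hp
  have hps : p ∈ (extChartAt (𝓡 m) q).source := (extChartAt (𝓡 m) q).map_target hz
  have hpz : extChartAt (𝓡 m) q p = z := (extChartAt (𝓡 m) q).right_inv hz
  obtain ⟨v, hv, hpos⟩ := (g.isLorentzForm p).signature
  have key : ∀ v w : Coord m, g.coord q z (chartDeriv q p v) (chartDeriv q p w) = g.form p v w := by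
    rw [← hpz]; exact g.coord_chartDeriv hps
  refine ⟨chartDeriv q p v, (key v v).trans_lt hv, fun w hw h0 ↦ ?_⟩
  have hw' : chartDeriv q p (chartSymmDeriv q z w) = w := chartDeriv_chartSymmDeriv hz w
  rw [← hw'] at hw ⊢
  rw [key]
  exact hpos _ ((key v _).symm.trans hw) fun h ↦ h0 (by rw [← hw']; exact (congrArg _ h).trans (map_zero _))

theorem coord_transition {q p : M} {z : Coord m}
    (hz : z ∈ (extChartAt (𝓡 m) q).target)
    (hp : (extChartAt (𝓡 m) q).symm z ∈ (extChartAt (𝓡 m) p).source) (v w : Coord m) :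
    g.coord q z v w = g.coord p (chartTransition q p z) (fderiv ℝ (chartTransition q p) z v)
      (fderiv ℝ (chartTransition q p) z w) := by
  rw [fderiv_chartTransition hz hp, fderiv_chartTransition hz hp, chartTransition,
    g.coord_chartDeriv hp, coord_apply]

/-- Smoothness of the metric as a bundle section passes to its coefficients by evaluation on the
coordinate fields, which are smooth sections of the tangent bundle; finitely many coefficients
determine the form. -/
theorem contDiffAt_coord {q : M} {z : Coord m} (hz : z ∈ (extChartAt (𝓡 m) q).target) :
    ContDiffAt ℝ ∞ (g.coord q) z := by
  have hsymm : ContMDiffAt 𝓘(ℝ, Coord m) (𝓡 m) ∞ (extChartAt (𝓡 m) q).symm z :=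
    (contMDiffOn_extChartAt_symm q).contMDiffAt ((isOpen_extChartAt_target q).mem_nhds hz)
  have hsrc : ∀ z ∈ (extChartAt (𝓡 m) q).target,
      (extChartAt (𝓡 m) q).symm z ∈ (chartAt (Coord m) q).source := fun z hz ↦ by
    simpa using (extChartAt (𝓡 m) q).map_target hz
  have hsec : ∀ v : Coord m, ContMDiffAt 𝓘(ℝ, Coord m) ((𝓡 m).prod 𝓘(ℝ, Coord m)) ∞
      (fun z ↦ TotalSpace.mk' (Coord m) (E := TangentSpace (𝓡 m)) ((extChartAt (𝓡 m) q).symm z)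
        (chartSymmDeriv q z v)) z := fun v ↦ by
    let e := trivializationAt (Coord m) (TangentSpace (𝓡 m) : M → Type _) q
    have h1 : ContMDiffAt ((𝓡 m).prod 𝓘(ℝ, Coord m)) ((𝓡 m).prod 𝓘(ℝ, Coord m)) ∞
        e.toOpenPartialHomeomorph.symm ((extChartAt (𝓡 m) q).symm z, v) := by
      refine (e.contMDiffOn_symm).contMDiffAt (e.open_target.mem_nhds ?_)
      rw [e.mem_target]
      simpa [e] using hsrc z hz
    have h2 := h1.comp z (hsymm.prodMk contMDiffAt_const)
    refine h2.congr_of_eventuallyEq ?_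
    filter_upwards [(isOpen_extChartAt_target q).mem_nhds hz] with z' hz'
    have h3 := TangentBundle.symmL_trivializationAt (I := 𝓡 m) (hsrc z' hz')
    rw [(extChartAt (𝓡 m) q).right_inv hz'] at h3
    have hb : (extChartAt (𝓡 m) q).symm z' ∈ e.baseSet := by simpa [e] using hsrc z' hz'
    rw [Function.comp_apply]
    have h4 := e.mk_symm hb v
    refine Eq.trans ?_ h4
    congr 1
    have h5 := (DFunLike.congr_fun h3 v).symm
    rwa [e.symmL_apply hb] at h5
  have hsc : ∀ v w : Coord m, ContDiffAt ℝ ∞ (fun z ↦ g.coord q z v w) z := fun v w ↦ by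
    have : ContMDiffAt 𝓘(ℝ, Coord m) ((𝓡 m).prod 𝓘(ℝ)) ∞
        (fun z ↦ TotalSpace.mk' ℝ (E := Bundle.Trivial M ℝ) ((extChartAt (𝓡 m) q).symm z)
          (g.inner ((extChartAt (𝓡 m) q).symm z) (chartSymmDeriv q z v) (chartSymmDeriv q z w)))
        z := by
      apply ContMDiffAt.clm_bundle_apply₂ (F₁ := Coord m) (F₂ := Coord m)
      · exact (g.contMDiff _).comp z hsymm
      · exact hsec v
      · exact hsec w
    rw [contMDiffAt_totalSpace] at this
    exact contMDiffAt_iff_contDiffAt.mp this.2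
  have hsum : g.coord q = fun z ↦ ∑ i, ∑ j, g.coord q z (stdVec i) (stdVec j) •
      ((EuclideanSpace.proj i : Coord m →L[ℝ] ℝ).smulRight
        (EuclideanSpace.proj j : Coord m →L[ℝ] ℝ)) := by
    ext1 z
    refine ContinuousLinearMap.ext fun v ↦ ContinuousLinearMap.ext fun w ↦ ?_
    rw [bilin_expand (g.coord q z) v w]
    simp only [sum_apply, smul_apply, ContinuousLinearMap.smulRight_apply,
      smul_eq_mul]
    refine Finset.sum_congr rfl fun i _ ↦ Finset.sum_congr rfl fun j _ ↦ ?_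
    change _ = _ * (v i * w j)
    ring
  rw [hsum]
  exact ContDiffAt.sum fun i _ ↦ ContDiffAt.sum fun j _ ↦ (hsc _ _).smul contDiffAt_const

theorem christoffel_eq (q : M) (z v w : Coord m) :
    g.christoffel q z v w = christoffelMap (g.coord q) z v w := by
  rw [christoffelMap_apply]; rfl

theorem riemann_eq (p : M) (u v w : Coord m) :
    g.riemann p u v w = curv (g.coord p) (extChartAt (𝓡 m) p p) u v w := by
  have hz := mem_extChartAt_target (I := 𝓡 m) p
  have hd : DifferentiableAt ℝ (christoffelMap (g.coord p)) (extChartAt (𝓡 m) p p) :=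
    (contDiffAt_christoffelMap (m := 1) (g.contDiffAt_coord hz)
      (g.isLorentzForm_coord hz).isInvertible
      (by norm_num; exact WithTop.coe_le_coe.mpr le_top)).differentiableAt one_ne_zero
  have key : ∀ u v w : Coord m, fderiv ℝ (fun z ↦ christoffelMap (g.coord p) z v w)
      (extChartAt (𝓡 m) p p) u
        = fderiv ℝ (christoffelMap (g.coord p)) (extChartAt (𝓡 m) p p) u v w := fun u v w ↦ by
    rw [fderiv_clm_apply (hd.clm_apply (differentiableAt_const v)) (differentiableAt_const w),
      fderiv_clm_apply hd (differentiableAt_const v)]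
    simp
  simp only [riemann, christoffel_eq, key, curv]

end LorentzMetric

end Charts

/-! ### Change of coordinates -/

section Transformation

variable {E F : Type} [NormedAddCommGroup E] [NormedSpace ℝ E]
  [NormedAddCommGroup F] [NormedSpace ℝ F]

/-- The transformation law of the Christoffel symbols under a change of coordinates `Φ`. -/
theorem christoffelMap_transform {G G' : F → F →L[ℝ] F →L[ℝ] ℝ} {Φ : F → F} {z : F}
    (hΦ : ContDiffAt ℝ 2 Φ z) (hsurj : Function.Surjective (fderiv ℝ Φ z))
    (hG : DifferentiableAt ℝ G z) (hG' : DifferentiableAt ℝ G' (Φ z))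
    (hs : ∀ v w, G' (Φ z) v w = G' (Φ z) w v)
    (hi : (G z).IsInvertible) (hi' : (G' (Φ z)).IsInvertible)
    (hGG : ∀ᶠ z' in 𝓝 z, ∀ v w, G z' v w = G' (Φ z') (fderiv ℝ Φ z' v) (fderiv ℝ Φ z' w))
    (v w : F) :
    fderiv ℝ Φ z (christoffelMap G z v w) = fderiv ℝ (fderiv ℝ Φ) z v w
      + christoffelMap G' (Φ z) (fderiv ℝ Φ z v) (fderiv ℝ Φ z w) := by
  have hd := differentiableAt_fderiv hΦ
  -- The pullback relation between the two metrics, differentiated by the chain rule.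
  have key : ∀ a b c : F, fderiv ℝ G z a b c
      = fderiv ℝ G' (Φ z) (fderiv ℝ Φ z a) (fderiv ℝ Φ z b) (fderiv ℝ Φ z c)
        + G' (Φ z) (fderiv ℝ (fderiv ℝ Φ) z a b) (fderiv ℝ Φ z c)
        + G' (Φ z) (fderiv ℝ Φ z b) (fderiv ℝ (fderiv ℝ Φ) z a c) := fun a b c ↦ by
    have h1 := fderiv_metric_fields (G := G) (Y := id) (x := z) differentiableAt_id hG
      (differentiableAt_const b) (differentiableAt_const c) a
    have h2 : (fun x ↦ G (id x) b c) =ᶠ[𝓝 z]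
        fun x ↦ G' (Φ x) (fderiv ℝ Φ x b) (fderiv ℝ Φ x c) := by
      filter_upwards [hGG] with z' hz' using hz' b c
    rw [h2.fderiv_eq, fderiv_metric_fields (hΦ.differentiableAt two_ne_zero) hG'
      (hd.clm_apply (differentiableAt_const b)) (hd.clm_apply (differentiableAt_const c)),
      fderiv_fderiv_apply hd, fderiv_fderiv_apply hd] at h1
    simpa using h1.symm
  -- Both sides are tested with `G'` against vectors `dΦ u`. In the Koszul combination all terms
  -- with second derivatives of `Φ` cancel except those containing `D²Φ(v, w)`.
  refine hi'.injective (ContinuousLinearMap.ext fun u' ↦ ?_)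
  obtain ⟨u, rfl⟩ := hsurj u'
  rw [← hGG.self_of_nhds, inner_christoffelMap hi, map_add, add_apply, inner_christoffelMap hi',
    key, key, key, fderiv_fderiv_comm hΦ w v, fderiv_fderiv_comm hΦ u v, fderiv_fderiv_comm hΦ u w,
    hs (fderiv ℝ Φ z w) (fderiv ℝ (fderiv ℝ Φ) z v u)]
  ring

/-- The first fundamental form of a map into a vector space with a metric. -/
def flatFirstForm (G : F → F →L[ℝ] F →L[ℝ] ℝ) (Y : E → F) (a : E) : E →L[ℝ] E →L[ℝ] ℝ :=
  (G (Y a)).bilinearComp (fderiv ℝ Y a) (fderiv ℝ Y a)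

/-- The covariant Hessian of a map into a vector space with a metric. -/
def flatHessian (G : F → F →L[ℝ] F →L[ℝ] ℝ) (Y : E → F) (a : E) : E →L[ℝ] E →L[ℝ] F :=
  fderiv ℝ (fderiv ℝ Y) a + (christoffelMap G (Y a)).bilinearComp (fderiv ℝ Y a) (fderiv ℝ Y a)

/-- The second fundamental form of a map into a vector space with a metric. -/
def flatSecondForm (G : F → F →L[ℝ] F →L[ℝ] ℝ) (Y : E → F) (a : E) (N : F) :
    E →L[ℝ] E →L[ℝ] ℝ :=
  (ContinuousLinearMap.compL ℝ E F ℝ (-(G (Y a) N))) ∘L flatHessian G Y a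

theorem flatFirstForm_apply (G : F → F →L[ℝ] F →L[ℝ] ℝ) (Y : E → F) (a u v : E) :
    flatFirstForm G Y a u v = G (Y a) (fderiv ℝ Y a u) (fderiv ℝ Y a v) := rfl

theorem flatHessian_apply (G : F → F →L[ℝ] F →L[ℝ] ℝ) (Y : E → F) (a u v : E) :
    flatHessian G Y a u v = fderiv ℝ (fderiv ℝ Y) a u v
      + christoffelMap G (Y a) (fderiv ℝ Y a u) (fderiv ℝ Y a v) := rfl

theorem flatSecondForm_apply (G : F → F →L[ℝ] F →L[ℝ] ℝ) (Y : E → F) (a u v : E) (N : F) :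
    flatSecondForm G Y a N u v = -G (Y a) N (flatHessian G Y a u v) := rfl

/-- The `D²Φ` term of the chain rule cancels the inhomogeneous term of the Christoffel symbols, so
the covariant Hessian transforms as a vector. -/
theorem flatHessian_comp {G G' : F → F →L[ℝ] F →L[ℝ] ℝ} {Φ : F → F} {Y : E → F} {a : E}
    (hY : ContDiffAt ℝ 2 Y a)
    (hΦ : ContDiffAt ℝ 2 Φ (Y a)) (hsurj : Function.Surjective (fderiv ℝ Φ (Y a)))
    (hG : DifferentiableAt ℝ G (Y a)) (hG' : DifferentiableAt ℝ G' (Φ (Y a)))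
    (hs : ∀ v w, G' (Φ (Y a)) v w = G' (Φ (Y a)) w v)
    (hi : (G (Y a)).IsInvertible) (hi' : (G' (Φ (Y a))).IsInvertible)
    (hGG : ∀ᶠ z' in 𝓝 (Y a), ∀ v w, G z' v w = G' (Φ z') (fderiv ℝ Φ z' v) (fderiv ℝ Φ z' w))
    (u v : E) :
    flatHessian G' (Φ ∘ Y) a u v = fderiv ℝ Φ (Y a) (flatHessian G Y a u v) := by
  have hY1 := hY.differentiableAt two_ne_zero
  have hΦ1 := hΦ.differentiableAt two_ne_zero
  have hcomp : ∀ᶠ x in 𝓝 a, fderiv ℝ (Φ ∘ Y) x = fderiv ℝ Φ (Y x) ∘L fderiv ℝ Y x := by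
    filter_upwards [hY.eventually (by simp), hY.continuousAt.eventually (hΦ.eventually (by simp))]
      with x h1 h2
    exact fderiv_comp x (h2.differentiableAt two_ne_zero) (h1.differentiableAt two_ne_zero)
  have hd : DifferentiableAt ℝ (fderiv ℝ (Φ ∘ Y)) a :=
    differentiableAt_fderiv (hΦ.comp a hY)
  have hdΦ : DifferentiableAt ℝ (fun x ↦ fderiv ℝ Φ (Y x)) a :=
    (differentiableAt_fderiv hΦ).comp a hY1
  have h1 : fderiv ℝ (fun x ↦ fderiv ℝ Φ (Y x)) a u
      = fderiv ℝ (fderiv ℝ Φ) (Y a) (fderiv ℝ Y a u) := by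
    rw [show (fun x ↦ fderiv ℝ Φ (Y x)) = fderiv ℝ Φ ∘ Y from rfl,
      fderiv_comp a (differentiableAt_fderiv hΦ) hY1]; rfl
  have h2 : (fun x ↦ fderiv ℝ (Φ ∘ Y) x v) =ᶠ[𝓝 a] fun x ↦ fderiv ℝ Φ (Y x) (fderiv ℝ Y x v) := by
    filter_upwards [hcomp] with x hx
    rw [hx]; rfl
  have h3 : fderiv ℝ (fderiv ℝ (Φ ∘ Y)) a u v
      = fderiv ℝ (fderiv ℝ Φ) (Y a) (fderiv ℝ Y a u) (fderiv ℝ Y a v)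
        + fderiv ℝ Φ (Y a) (fderiv ℝ (fderiv ℝ Y) a u v) := by
    rw [← fderiv_fderiv_apply hd, h2.fderiv_eq, fderiv_clm_apply hdΦ
      ((differentiableAt_fderiv hY).clm_apply (differentiableAt_const v))]
    simp only [add_apply, ContinuousLinearMap.comp_apply, ContinuousLinearMap.flip_apply, h1,
      fderiv_fderiv_apply (differentiableAt_fderiv hY)]
    abel
  rw [flatHessian_apply, flatHessian_apply, map_add,
    christoffelMap_transform hΦ hsurj hG hG' hs hi hi' hGG, h3, hcomp.self_of_nhds]
  simp only [Function.comp_apply, ContinuousLinearMap.comp_apply]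
  abel

end Transformation

/-! ### Time slices of a family, and the second derivative test -/

section TimeSlices

variable {E F : Type} [NormedAddCommGroup E] [NormedSpace ℝ E]
  [NormedAddCommGroup F] [NormedSpace ℝ F] {G : F → F →L[ℝ] F →L[ℝ] ℝ} {Y : E × ℝ → F} {a : E} {s : ℝ}

theorem fderiv_slice {H : Type} [NormedAddCommGroup H] [NormedSpace ℝ H] {Y : E × ℝ → H}
    (hY : DifferentiableAt ℝ Y (a, s)) (u : E) :
    fderiv ℝ (fun a' ↦ Y (a', s)) a u = fderiv ℝ Y (a, s) (u, 0) := by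
  have h1 : HasFDerivAt (fun a' : E ↦ (a', s)) ((ContinuousLinearMap.id ℝ E).prod 0) a :=
    (hasFDerivAt_id a).prodMk (hasFDerivAt_const s a)
  have h := HasFDerivAt.comp a (g := Y) (f := fun a' : E ↦ (a', s)) hY.hasFDerivAt h1
  exact DFunLike.congr_fun h.fderiv u

theorem fderiv_fderiv_slice (hY : ContDiffAt ℝ 2 Y (a, s)) (u v : E) :
    fderiv ℝ (fderiv ℝ fun a' ↦ Y (a', s)) a u v
      = fderiv ℝ (fderiv ℝ Y) (a, s) (u, 0) (v, 0) := by
  have hsl : ContDiffAt ℝ 2 (fun a' ↦ Y (a', s)) a :=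
    ContDiffAt.comp a hY (contDiffAt_id.prodMk contDiffAt_const)
  have hc : ContinuousAt (fun a' : E ↦ (a', s)) a := by fun_prop
  have h1 : (fun a' ↦ fderiv ℝ (fun a' ↦ Y (a', s)) a' v) =ᶠ[𝓝 a]
      fun a' ↦ (fun z ↦ fderiv ℝ Y z (v, 0)) (a', s) := by
    filter_upwards [hc.eventually (hY.eventually (by simp))] with a' ha'
    exact fderiv_slice (ha'.differentiableAt two_ne_zero) v
  rw [← fderiv_fderiv_apply (differentiableAt_fderiv hsl), h1.fderiv_eq,
    fderiv_slice ((differentiableAt_fderiv hY).clm_apply (differentiableAt_const _)),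
    fderiv_fderiv_apply (differentiableAt_fderiv hY)]

/-- Places the Hessian of one slice on space times time, where the variation formulas apply. -/
theorem flatHessian_slice (hY : ContDiffAt ℝ 2 Y (a, s)) (u v : E) :
    flatHessian G (fun a' ↦ Y (a', s)) a u v
      = cov G Y (fun z ↦ fderiv ℝ Y z (v, 0)) (u, 0) (a, s) := by
  have hY1 := hY.differentiableAt two_ne_zero
  rw [flatHessian_apply, fderiv_fderiv_slice hY, fderiv_slice hY1, fderiv_slice hY1, cov,
    fderiv_fderiv_apply (differentiableAt_fderiv hY)]

/-- The second derivative at a local maximum along a line is nonpositive. -/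
theorem fderiv_fderiv_nonpos_of_isLocalMax {k : E → ℝ} {x u : E} (hk : ContDiffAt ℝ 2 k x)
    (hmax : IsLocalMax (fun r : ℝ ↦ k (x + r • u)) 0) :
    fderiv ℝ (fun z ↦ fderiv ℝ k z u) x u ≤ 0 := by
  set φ : ℝ → ℝ := fun r ↦ k (x + r • u) with hφ
  have hline : ∀ r : ℝ, HasDerivAt (fun r : ℝ ↦ x + r • u) u r := fun r ↦ by
    simpa using ((hasDerivAt_id r).smul_const u).const_add x
  have hx : x + (0 : ℝ) • u = x := by simp
  have hc : ContinuousAt (fun r : ℝ ↦ x + r • u) 0 := (hline 0).continuousAt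
  have hd : deriv φ =ᶠ[𝓝 0] fun r ↦ fderiv ℝ k (x + r • u) u := by
    have : ∀ᶠ z in 𝓝 (x + (0 : ℝ) • u), ContDiffAt ℝ 2 k z := by
      rw [hx]; exact hk.eventually (by simp)
    filter_upwards [hc.eventually this] with r hr
    exact ((hr.differentiableAt two_ne_zero).hasFDerivAt.comp_hasDerivAt r (hline r)).deriv
  have hdd : deriv (deriv φ) 0 = fderiv ℝ (fun z ↦ fderiv ℝ k z u) x u := by
    rw [hd.deriv_eq]
    have h1 : DifferentiableAt ℝ (fun z ↦ fderiv ℝ k z u) (x + (0 : ℝ) • u) := by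
      rw [hx]; exact (differentiableAt_fderiv hk).clm_apply (differentiableAt_const u)
    have h2 := (h1.hasFDerivAt.comp_hasDerivAt 0 (hline 0)).deriv
    rw [hx] at h2
    exact h2
  rw [← hdd]
  -- With a positive second derivative the point would also be a local minimum, so `φ` would be
  -- locally constant and its second derivative zero.
  by_contra hpos
  push Not at hpos
  have hmin := isLocalMin_of_deriv_deriv_pos hpos hmax.deriv_eq_zero
    (by rw [hφ]; exact (ContinuousAt.comp (by rw [hx]; exact hk.continuousAt) hc))
  have hconst : φ =ᶠ[𝓝 0] fun _ ↦ φ 0 := by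
    filter_upwards [hmin, hmax] with r h1 h2 using le_antisymm h2 h1
  have hconst' : deriv φ =ᶠ[𝓝 0] fun _ ↦ 0 := by
    filter_upwards [hconst.eventuallyEq_nhds] with r hr
    rw [hr.deriv_eq, deriv_const]
  rw [hconst'.deriv_eq, deriv_const] at hpos
  exact lt_irrefl _ hpos

end TimeSlices

/-! ### Evolution of the mean curvature at a spatial maximum -/

section Evolution

variable {n : ℕ} {G : Coord (n + 1) → Coord (n + 1) →L[ℝ] Coord (n + 1) →L[ℝ] ℝ}
  {Y N : Coord n × ℝ → Coord (n + 1)} {k : Coord n × ℝ → ℝ} {a : Coord n} {s₀ : ℝ}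

/-- The Ricci curvature in the direction of the normal, in an orthonormal frame. -/
theorem sum_curv_eq {z : Coord (n + 1)} {e : Fin n → Coord (n + 1)} {ν : Coord (n + 1)}
    (he : IsLorentzFrame (G z) e ν) :
    ∑ i, (curv G z (stdVec i) ν ν) i = -∑ i, G z (curv G z ν (e i) ν) (e i) := by
  -- The operator `R(·, ν) ν` annihilates `ν`, so its trace is the sum over the tangential frame
  -- vectors.
  let L : Coord (n + 1) →ₗ[ℝ] Coord (n + 1) :=
    { toFun := fun w ↦ curv G z w ν ν
      map_add' := fun v w ↦ by simp only [curv, map_add, add_apply]; abel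
      map_smul' := fun c w ↦ curv_smul_left G z w ν ν c }
  have h0 : L ν = 0 := by
    change curv G z ν ν ν = 0
    simp [curv]
  have h := he.trace_eq L
  rw [h0, map_zero, zero_apply, sub_zero] at h
  rw [← Finset.sum_neg_distrib]
  refine h.trans (Finset.sum_congr rfl fun i _ ↦ ?_)
  change G z (curv G z (e i) ν ν) (e i) = _
  rw [curv_swap, map_neg, neg_apply]

/-- At a spatial maximum of the mean curvature `k` of a mean curvature flow, `k` decreases strictly
provided that `k² > n c`, where `-c` is a lower bound for the Ricci curvature of the normal. -/
theorem hasDerivAt_speed_neg_of_isLocalMax (hn : 0 < n)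
    (h : NormalFlowAt G Y N k (range fun u : Coord n ↦ (u, (0 : ℝ))) (0, 1) (a, s₀))
    (hpos : ∀ u : Coord n, u ≠ 0 →
      0 < G (Y (a, s₀)) (fderiv ℝ Y (a, s₀) (u, 0)) (fderiv ℝ Y (a, s₀) (u, 0)))
    (hmean : ∀ᶠ s in 𝓝 s₀, k (a, s) = ∑ i, ∑ j,
      (Matrix.of fun i j ↦ flatFirstForm G (fun a' ↦ Y (a', s)) a (stdVec i) (stdVec j))⁻¹ i j
        * flatSecondForm G (fun a' ↦ Y (a', s)) a (N (a, s)) (stdVec i) (stdVec j))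
    (hmax : IsLocalMax (fun a' ↦ k (a', s₀)) a) {c : ℝ}
    (hric : -c ≤ ∑ i, (curv G (Y (a, s₀)) (stdVec i) (N (a, s₀)) (N (a, s₀))) i)
    (hk : 0 < k (a, s₀)) (hkc : n * c < k (a, s₀) ^ 2) :
    ∃ d < 0, HasDerivAt (fun s ↦ k (a, s)) d s₀ := by
  set P : Set (Coord n × ℝ) := range fun u : Coord n ↦ (u, (0 : ℝ)) with hP
  have hmem : ∀ u : Coord n, (u, (0 : ℝ)) ∈ P := fun u ↦ ⟨u, rfl⟩
  have hline : ∀ s : ℝ, HasDerivAt (fun s : ℝ ↦ (a, s)) ((0 : Coord n), (1 : ℝ)) s := fun s ↦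
    (hasDerivAt_const s a).prodMk (hasDerivAt_id s)
  have hlc : ContinuousAt (fun s : ℝ ↦ (a, s)) s₀ := (hline s₀).continuousAt
  have hcrit : ∀ u : Coord n, fderiv ℝ k (a, s₀) (u, 0) = 0 := fun u ↦ by
    rw [← fderiv_slice h.differentiableAt_speed, hmax.fderiv_eq_zero]; rfl
  have hhess : ∀ u : Coord n, fderiv ℝ (fun z ↦ fderiv ℝ k z (u, 0)) (a, s₀) (u, 0) ≤ 0 := fun u ↦ by
    refine fderiv_fderiv_nonpos_of_isLocalMax h.smooth_speed ?_
    have hc : ContinuousAt (fun r : ℝ ↦ a + r • u) 0 := by fun_prop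
    have hev : ∀ᶠ r in 𝓝 (0 : ℝ), k (a + r • u, s₀) ≤ k (a, s₀) := by
      refine hc.eventually (p := fun a' ↦ k (a', s₀) ≤ k (a, s₀)) ?_
      have hm : ∀ᶠ a' in 𝓝 a, k (a', s₀) ≤ k (a, s₀) := hmax
      simpa using hm
    filter_upwards [hev] with r hr
    simpa using hr
  have hsl : ∀ᶠ s in 𝓝 s₀, ∀ u v : Coord n,
      flatFirstForm G (fun a' ↦ Y (a', s)) a u v
        = G (Y (a, s)) (fderiv ℝ Y (a, s) (u, 0)) (fderiv ℝ Y (a, s) (v, 0)) ∧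
      flatSecondForm G (fun a' ↦ Y (a', s)) a (N (a, s)) u v
        = -G (Y (a, s)) (N (a, s)) (cov G Y (fun z ↦ fderiv ℝ Y z (v, 0)) (u, 0) (a, s)) := by
    filter_upwards [hlc.eventually h.eventually] with s hs u v
    rw [flatFirstForm_apply, fderiv_slice hs.differentiableAt, fderiv_slice hs.differentiableAt,
      flatSecondForm_apply, flatHessian_slice hs.contDiffAt_two]
    exact ⟨rfl, rfl⟩
  have hsl₀ := hsl.self_of_nhds
  -- The frame is orthonormal at time `s₀` only; its coordinate vectors are kept fixed at nearby
  -- times.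
  obtain ⟨f, hf⟩ := exists_orthonormal_frame (flatFirstForm G (fun a' ↦ Y (a', s₀)) a)
    (fun u v ↦ by rw [(hsl₀ _ _).1, (hsl₀ _ _).1, h.inner_comm])
    (fun u hu ↦ by rw [(hsl₀ _ _).1]; exact hpos u hu)
  set e : Fin n → Coord (n + 1) := fun i ↦ fderiv ℝ Y (a, s₀) (f i, 0) with he
  have hframe : IsLorentzFrame (G (Y (a, s₀))) e (N (a, s₀)) :=
    ⟨h.inner_comm, fun i j ↦ by rw [← hf, (hsl₀ _ _).1],
      fun i ↦ h.normal.self_of_nhds _ (hmem _), h.unit.self_of_nhds⟩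
  -- The tangential components of `∇_l N` are the derivatives of `k`, which vanish at the maximum,
  -- and the normal component vanishes since `N` has constant length.
  have hNl : cov G Y N (0, 1) (a, s₀) = 0 := by
    rw [hframe.expand (cov G Y N (0, 1) (a, s₀)), h.inner_cov_normal_normal]
    simp [he, h.inner_cov_normal_flow (hmem _), hcrit]
  set β : Fin n → Fin n → ℝ := fun i j ↦ G (Y (a, s₀)) (cov G Y N (f i, 0) (a, s₀)) (e j) with hβ
  have hb₀ : ∀ i j, flatSecondForm G (fun a' ↦ Y (a', s₀)) a (N (a, s₀)) (f i) (f j) = β i j :=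
    fun i j ↦ by
      rw [(hsl₀ _ _).2, h.inner_normal_cov_partial (hmem _), neg_neg]
  have hdh : ∀ i j, HasDerivAt (fun s ↦ flatFirstForm G (fun a' ↦ Y (a', s)) a (f i) (f j))
      (2 * k (a, s₀) * β i j) s₀ := fun i j ↦ by
    have hd : DifferentiableAt ℝ (fun z ↦ G (Y z) (fderiv ℝ Y z (f i, 0)) (fderiv ℝ Y z (f j, 0)))
        (a, s₀) := by
      have hGY : DifferentiableAt ℝ (fun x ↦ G (Y x)) (a, s₀) :=
        h.differentiableAt_metric.comp _ h.differentiableAt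
      exact (hGY.clm_apply (h.differentiableAt_partial _)).clm_apply (h.differentiableAt_partial _)
    have h1 := hd.hasFDerivAt.comp_hasDerivAt s₀ (hline s₀)
    rw [h.fderiv_firstForm (hmem _) (hmem _)] at h1
    refine h1.congr_of_eventuallyEq ?_
    filter_upwards [hsl] with s hs using (hs _ _).1
  have hdb : ∀ i j, HasDerivAt
      (fun s ↦ flatSecondForm G (fun a' ↦ Y (a', s)) a (N (a, s)) (f i) (f j))
      (fderiv ℝ (fun z ↦ fderiv ℝ k z (f j, 0)) (a, s₀) (f i, 0)
        + k (a, s₀) * G (Y (a, s₀)) (curv G (Y (a, s₀)) (N (a, s₀)) (e i) (N (a, s₀))) (e j)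
        + k (a, s₀) * G (Y (a, s₀)) (cov G Y N (f i, 0) (a, s₀)) (cov G Y N (f j, 0) (a, s₀))) s₀ :=
    fun i j ↦ by
      have hev : (fun z ↦ -G (Y z) (N z) (cov G Y (fun z ↦ fderiv ℝ Y z (f j, 0)) (f i, 0) z))
          =ᶠ[𝓝 (a, s₀)] fun z ↦ G (Y z) (cov G Y N (f i, 0) z) (fderiv ℝ Y z (f j, 0)) := by
        filter_upwards [h.eventually] with z hz
        rw [hz.inner_normal_cov_partial (hmem _), neg_neg]
      have hd : DifferentiableAt ℝ
          (fun z ↦ -G (Y z) (N z) (cov G Y (fun z ↦ fderiv ℝ Y z (f j, 0)) (f i, 0) z))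
          (a, s₀) := by
        refine DifferentiableAt.congr_of_eventuallyEq ?_ hev
        have hGY : DifferentiableAt ℝ (fun x ↦ G (Y x)) (a, s₀) :=
          h.differentiableAt_metric.comp _ h.differentiableAt
        exact (hGY.clm_apply (h.differentiableAt_cov_normal _)).clm_apply
          (h.differentiableAt_partial _)
      have h1 := hd.hasFDerivAt.comp_hasDerivAt s₀ (hline s₀)
      rw [h.fderiv_secondForm (hmem _) (hcrit _) hNl] at h1
      refine h1.congr_of_eventuallyEq ?_
      filter_upwards [hsl] with s hs using (hs _ _).2
  -- At the maximum this is `∂k = Δk - k (|β|² + Ric(N, N))`: the induced metric contributes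
  -- `-2k|β|²`, the second fundamental form `+k|β|²`.
  have hder := (hasDerivAt_trace_form hf hdh hdb).congr_of_eventuallyEq hmean
  refine ⟨_, ?_, hder⟩
  have hk₀ : k (a, s₀) = ∑ i, β i i := by
    rw [hmean.self_of_nhds, trace_form_eq_sum hf]
    exact Finset.sum_congr rfl fun i _ ↦ hb₀ i i
  have hsq : ∀ i, G (Y (a, s₀)) (cov G Y N (f i, 0) (a, s₀)) (cov G Y N (f i, 0) (a, s₀))
      = ∑ j, β i j ^ 2 := fun i ↦ by
    rw [hframe.inner_eq_sum (h.inner_cov_normal_normal _)]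
    exact Finset.sum_congr rfl fun j _ ↦ (sq _).symm
  have hric' := sum_curv_eq hframe
  set B := ∑ i, ∑ j, β i j ^ 2 with hB
  -- Cauchy-Schwarz on the diagonal of `β`, then the off-diagonal squares are added.
  have hkB : k (a, s₀) ^ 2 ≤ n * B := by
    have h1 := sq_sum_le_card_mul_sum_sq (s := (Finset.univ : Finset (Fin n))) (f := fun i ↦ β i i)
    rw [← hk₀, Finset.card_univ, Fintype.card_fin] at h1
    refine h1.trans (mul_le_mul_of_nonneg_left ?_ (Nat.cast_nonneg n))
    exact Finset.sum_le_sum fun i _ ↦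
      Finset.single_le_sum (f := fun j ↦ β i j ^ 2) (fun j _ ↦ sq_nonneg _) (Finset.mem_univ i)
  simp only [hb₀, hsq, Finset.sum_add_distrib, ← Finset.mul_sum]
  rw [← hB]
  have h2 : ∑ i, ∑ j, 2 * k (a, s₀) * β i j * β i j = 2 * k (a, s₀) * B := by
    rw [hB, Finset.mul_sum]
    refine Finset.sum_congr rfl fun i _ ↦ ?_
    rw [Finset.mul_sum]
    exact Finset.sum_congr rfl fun j _ ↦ by ring
  rw [h2]
  have h3 : ∑ i, fderiv ℝ (fun z ↦ fderiv ℝ k z (f i, 0)) (a, s₀) (f i, 0) ≤ 0 :=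
    Finset.sum_nonpos fun i _ ↦ hhess (f i)
  have h4 : ∑ i, G (Y (a, s₀)) (curv G (Y (a, s₀)) (N (a, s₀)) (e i) (N (a, s₀))) (e i) ≤ c := by
    linarith
  have hn' : (0 : ℝ) < n := Nat.cast_pos.mpr hn
  have hcB : c < B := by
    have : (n : ℝ) * c < n * B := lt_of_lt_of_le hkc hkB
    exact lt_of_mul_lt_mul_left this hn'.le
  nlinarith [mul_pos hk (sub_pos.mpr hcB), mul_nonneg hk.le (sub_nonneg.mpr h4)]

end Evolution

/-! ### Fundamental forms of a hypersurface in a fixed chart -/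

section ChartMaps

variable {n : ℕ} {M : Type*} [TopologicalSpace M] [ChartedSpace (Coord (n + 1)) M]
  [IsManifold (𝓡 (n + 1)) ∞ M] {S : Type*} [TopologicalSpace S] [ChartedSpace (Coord n) S]
  [IsManifold (𝓡 n) ∞ S]

/-- The differential of a map from an `n`-manifold to the spacetime. -/
def mapDeriv (y : S → M) (x : S) : Coord n →L[ℝ] Coord (n + 1) :=
  mfderiv (𝓡 n) (𝓡 (n + 1)) y x

/-- A map of an `n`-manifold into the spacetime, in the preferred charts at `x` and `q`. -/
def chartMap (q : M) (x : S) (y : S → M) (a : Coord n) : Coord (n + 1) :=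
  extChartAt (𝓡 (n + 1)) q (y ((extChartAt (𝓡 n) x).symm a))

theorem fderiv_chartMap {q : M} {x : S} {y : S → M} {a : Coord n}
    (ha : a ∈ (extChartAt (𝓡 n) x).target)
    (hy : MDifferentiableAt (𝓡 n) (𝓡 (n + 1)) y ((extChartAt (𝓡 n) x).symm a))
    (hq : y ((extChartAt (𝓡 n) x).symm a) ∈ (extChartAt (𝓡 (n + 1)) q).source) (u : Coord n) :
    fderiv ℝ (chartMap q x y) a u = chartDeriv q (y ((extChartAt (𝓡 n) x).symm a))
      (mapDeriv y ((extChartAt (𝓡 n) x).symm a) (chartSymmDeriv x a u)) := by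
  have h2 : MDifferentiableAt (𝓡 (n + 1)) 𝓘(ℝ, Coord (n + 1)) (extChartAt (𝓡 (n + 1)) q)
      (y ((extChartAt (𝓡 n) x).symm a)) := mdifferentiableAt_extChartAt (by simpa using hq)
  have h1 := mdifferentiableAt_extChartAt_symm ha
  have h3 := mfderiv_comp a hy h1
  have h4 := mfderiv_comp a (g := extChartAt (𝓡 (n + 1)) q) (f := y ∘ (extChartAt (𝓡 n) x).symm)
    h2 (hy.comp a h1)
  rw [mfderiv_eq_fderiv, h3] at h4
  rw [chartSymmDeriv_eq_mfderiv]
  exact DFunLike.congr_fun h4 u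

theorem contDiffAt_chartMap {q : M} {x : S} {y : S → M} {a : Coord n}
    (ha : a ∈ (extChartAt (𝓡 n) x).target)
    (hy : ContMDiffAt (𝓡 n) (𝓡 (n + 1)) ∞ y ((extChartAt (𝓡 n) x).symm a))
    (hq : y ((extChartAt (𝓡 n) x).symm a) ∈ (extChartAt (𝓡 (n + 1)) q).source) :
    ContDiffAt ℝ ∞ (chartMap q x y) a := by
  rw [← contMDiffAt_iff_contDiffAt]
  have h1 : ContMDiffAt 𝓘(ℝ, Coord n) (𝓡 n) ∞ (extChartAt (𝓡 n) x).symm a :=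
    (contMDiffOn_extChartAt_symm x).contMDiffAt ((isOpen_extChartAt_target x).mem_nhds ha)
  have h2 : ContMDiffAt (𝓡 (n + 1)) 𝓘(ℝ, Coord (n + 1)) ∞ (extChartAt (𝓡 (n + 1)) q)
      (y ((extChartAt (𝓡 n) x).symm a)) := contMDiffAt_extChartAt' (by simpa using hq)
  exact h2.comp a (hy.comp a h1)

variable (g : LorentzMetric (n + 1) M)

theorem firstForm_eq {q : M} {x : S} {y : S → M}
    (hy : ContMDiffAt (𝓡 n) (𝓡 (n + 1)) ∞ y x)
    (hq : y x ∈ (extChartAt (𝓡 (n + 1)) q).source) (u v : Coord n) :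
    firstForm g y x u v
      = flatFirstForm (g.coord q) (chartMap q x y) (extChartAt (𝓡 n) x x) u v := by
  have hx : (extChartAt (𝓡 n) x).symm (extChartAt (𝓡 n) x x) = x := extChartAt_to_inv x
  have hd : ∀ u, fderiv ℝ (chartMap q x y) (extChartAt (𝓡 n) x x) u
      = chartDeriv q (y x) (mapDeriv y x u) := fun u ↦ by
    rw [fderiv_chartMap (mem_extChartAt_target x)
      (by rw [hx]; exact hy.mdifferentiableAt (by simp)) (by rwa [hx]), chartSymmDeriv_self, hx]
    rfl
  rw [flatFirstForm_apply, hd, hd]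
  rw [show chartMap q x y (extChartAt (𝓡 n) x x) = extChartAt (𝓡 (n + 1)) q (y x) by
    rw [chartMap, hx], g.coord_chartDeriv hq]
  rfl

/-- The definition uses the preferred chart at `y x`, which changes as `y x` moves. Since the
covariant Hessian and the metric are tensorial, any chart at `q` around the point gives the same
value. -/
theorem secondForm_eq {q : M} {x : S} {y : S → M}
    (hy : ContMDiffAt (𝓡 n) (𝓡 (n + 1)) ∞ y x)
    (hq : y x ∈ (extChartAt (𝓡 (n + 1)) q).source) (ν : Coord (n + 1)) (u v : Coord n) :
    secondForm g y x ν u v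
      = flatSecondForm (g.coord q) (chartMap q x y) (extChartAt (𝓡 n) x x)
        (chartDeriv q (y x) ν) u v := by
  set a := extChartAt (𝓡 n) x x with ha
  set p := y x with hp
  have hx : (extChartAt (𝓡 n) x).symm a = x := extChartAt_to_inv x
  have hat : a ∈ (extChartAt (𝓡 n) x).target := mem_extChartAt_target x
  set z := extChartAt (𝓡 (n + 1)) q p with hz
  have hzt : z ∈ (extChartAt (𝓡 (n + 1)) q).target := (extChartAt (𝓡 (n + 1)) q).map_source hq
  have hzp : (extChartAt (𝓡 (n + 1)) q).symm z = p := (extChartAt (𝓡 (n + 1)) q).left_inv hq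
  have hYa : chartMap q x y a = z := by rw [chartMap, hx]
  have hps : (extChartAt (𝓡 (n + 1)) q).symm z ∈ (extChartAt (𝓡 (n + 1)) p).source := by
    rw [hzp]; exact mem_extChartAt_source p
  have hΦz : chartTransition q p z = extChartAt (𝓡 (n + 1)) p p := by rw [chartTransition, hzp]
  have hY : ContDiffAt ℝ 2 (chartMap q x y) a :=
    (contDiffAt_chartMap hat (by rwa [hx]) (by rwa [hx])).of_le (WithTop.coe_le_coe.mpr le_top)
  have hΦ : ContDiffAt ℝ 2 (chartTransition q p) z :=
    (contDiffAt_chartTransition hzt hps).of_le (WithTop.coe_le_coe.mpr le_top)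
  have hpt : extChartAt (𝓡 (n + 1)) p p ∈ (extChartAt (𝓡 (n + 1)) p).target :=
    mem_extChartAt_target p
  have hev : ∀ᶠ z' in 𝓝 z, z' ∈ (extChartAt (𝓡 (n + 1)) q).target ∧
      (extChartAt (𝓡 (n + 1)) q).symm z' ∈ (extChartAt (𝓡 (n + 1)) p).source := by
    exact Filter.inter_mem ((isOpen_extChartAt_target q).mem_nhds hzt)
      ((continuousAt_extChartAt_symm'' hzt).preimage_mem_nhds
        ((isOpen_extChartAt_source p).mem_nhds hps))
  have hsurj : Function.Surjective (fderiv ℝ (chartTransition q p) z) := fun w ↦ by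
    refine ⟨chartDeriv q p (chartSymmDeriv p (extChartAt (𝓡 (n + 1)) p p) w), ?_⟩
    rw [fderiv_chartTransition hzt hps, hzp, chartSymmDeriv_chartDeriv hq, chartDeriv_self,
      chartSymmDeriv_self]
    rfl
  have hcomp : chartMap p x y =ᶠ[𝓝 a] chartTransition q p ∘ chartMap q x y := by
    have h1 : ContinuousAt (fun a ↦ y ((extChartAt (𝓡 n) x).symm a)) a := by
      refine ContinuousAt.comp (g := y) (by rw [hx]; exact hy.continuousAt) ?_
      exact continuousAt_extChartAt_symm x
    have h2 : (extChartAt (𝓡 (n + 1)) q).source ∈ 𝓝 (y ((extChartAt (𝓡 n) x).symm a)) := by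
      rw [hx]; exact (isOpen_extChartAt_source q).mem_nhds hq
    filter_upwards [h1.preimage_mem_nhds h2] with a' ha'
    rw [Function.comp_apply, chartTransition, chartMap, chartMap,
      (extChartAt (𝓡 (n + 1)) q).left_inv ha']
  have hcov : covHessian g y x u v
      = fderiv ℝ (chartTransition q p) z (flatHessian (g.coord q) (chartMap q x y) a u v) := by
    have h1 : covHessian g y x u v = flatHessian (g.coord p) (chartMap p x y) a u v := by
      rw [flatHessian_apply, ← LorentzMetric.christoffel_eq, chartMap, hx]
      rfl
    have h2 : flatHessian (g.coord p) (chartMap p x y) a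
        = flatHessian (g.coord p) (chartTransition q p ∘ chartMap q x y) a := by
      rw [flatHessian, flatHessian, hcomp.fderiv.fderiv_eq, hcomp.fderiv_eq, hcomp.self_of_nhds]
    rw [h1, h2, flatHessian_comp (G := g.coord q) hY (by rwa [hYa]) (by rwa [hYa])
      (by rw [hYa]; exact (g.contDiffAt_coord hzt).differentiableAt (by simp))
      (by rw [hYa, hΦz]; exact (g.contDiffAt_coord hpt).differentiableAt (by simp))
      (g.coord_symm p _)
      (by rw [hYa]; exact (g.isLorentzForm_coord hzt).isInvertible)
      (by rw [hYa, hΦz]; exact (g.isLorentzForm_coord hpt).isInvertible)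
      (by rw [hYa]; filter_upwards [hev] with z' hz' using g.coord_transition hz'.1 hz'.2), hYa]
  rw [flatSecondForm_apply, hYa, g.coord_transition hzt hps, ← hcov, hΦz,
    fderiv_chartTransition hzt hps, hzp, chartSymmDeriv_chartDeriv hq, chartDeriv_self, g.coord_self]
  rfl

theorem meanCurvature_eq {q : M} {x : S} {y : S → M}
    (hy : ContMDiffAt (𝓡 n) (𝓡 (n + 1)) ∞ y x)
    (hq : y x ∈ (extChartAt (𝓡 (n + 1)) q).source) (ν : Coord (n + 1)) :
    meanCurvature g y x ν = ∑ i, ∑ j,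
      (Matrix.of fun i j ↦ flatFirstForm (g.coord q) (chartMap q x y) (extChartAt (𝓡 n) x x)
        (stdVec i) (stdVec j))⁻¹ i j
        * flatSecondForm (g.coord q) (chartMap q x y) (extChartAt (𝓡 n) x x)
          (chartDeriv q (y x) ν) (stdVec i) (stdVec j) := by
  simp only [← secondForm_eq g hy hq, ← firstForm_eq g hy hq]
  rfl

end ChartMaps

/-! ### Einstein equations, Ricci bound and future normal -/

section Normals

variable {n : ℕ} {M : Type*} [TopologicalSpace M] [ChartedSpace (Coord (n + 1)) M]
  [IsManifold (𝓡 (n + 1)) ∞ M]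

namespace LorentzMetric

variable {m : ℕ} {M : Type*} [TopologicalSpace M] [ChartedSpace (Coord m) M]
  [IsManifold (𝓡 m) ∞ M] (g : LorentzMetric m M)

theorem form_grad (f : M → ℝ) (p : M) (v : Coord m) :
    g.form p (g.grad f p) v = differential f p v := by
  have h : g.form p ((g.form p).inverse (differential f p)) = differential (m := m) f p :=
    (g.isLorentzForm p).isInvertible.self_apply_inverse _
  exact DFunLike.congr_fun h v

/-- A kernel vector of the Gram matrix would be orthogonal to the whole tangent space. -/
theorem isUnit_det_gram (p : M) : IsUnit (g.gram p).det := by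
  rw [isUnit_iff_ne_zero]
  intro h0
  obtain ⟨v, hv, h⟩ := Matrix.exists_mulVec_eq_zero_iff.mpr h0
  refine hv ?_
  let w : Coord m := WithLp.toLp 2 v
  have hw : w = 0 := (g.isLorentzForm p).eq_zero_of_inner_eq_zero fun u ↦ by
    rw [(g.isLorentzForm p).symm, bilin_expand]
    refine Finset.sum_eq_zero fun i _ ↦ ?_
    have hi := congrFun h i
    simp only [Matrix.mulVec, dotProduct, Pi.zero_apply] at hi
    have : ∑ j, u i * w j * g.form p (stdVec i) (stdVec j)
        = u i * ∑ j, g.gram p i j * v j := by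
      rw [Finset.mul_sum]
      refine Finset.sum_congr rfl fun j _ ↦ ?_
      change u i * v j * g.gram p i j = _
      ring
    rw [this, hi, mul_zero]
  ext i
  exact congrArg (fun w : Coord m ↦ w i) hw

theorem traceForm_inner (p : M) : g.traceForm p (fun v w ↦ g.inner p v w) = m := by
  have h1 : g.traceForm p (fun v w ↦ g.inner p v w)
      = ∑ i, ∑ j, (g.gram p)⁻¹ i j * g.gram p j i := by
    refine Finset.sum_congr rfl fun i _ ↦ Finset.sum_congr rfl fun j _ ↦ ?_
    congr 1
    exact g.symm p _ _
  have h2 : ∑ i, ∑ j, (g.gram p)⁻¹ i j * g.gram p j i = ((g.gram p)⁻¹ * g.gram p).trace := by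
    simp [Matrix.trace, Matrix.mul_apply]
  rw [h1, h2, Matrix.nonsing_inv_mul _ (g.isUnit_det_gram p), Matrix.trace_one, Fintype.card_fin]

end LorentzMetric

namespace Cosmology

variable (X : Cosmology n M)

theorem traceForm_stress (G Λ : ℝ) (p : M) :
    X.g.traceForm p (X.stress G Λ p)
      = (8 * Real.pi * G)⁻¹ * (X.g.scalar p - X.g.scalar p / 2 * (n + 1)) + Λ * (n + 1) := by
  have h1 := X.g.traceForm_inner p
  have h2 : X.g.scalar p = X.g.traceForm p (X.g.ricci p) := rfl
  have h3 : X.g.traceForm p (X.stress G Λ p)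
      = (8 * Real.pi * G)⁻¹ * X.g.traceForm p (X.g.ricci p)
        + (Λ - (8 * Real.pi * G)⁻¹ * (X.g.scalar p / 2))
          * X.g.traceForm p (fun v w ↦ X.g.inner p v w) := by
    simp only [LorentzMetric.traceForm, stress, Finset.mul_sum, ← Finset.sum_add_distrib]
    refine Finset.sum_congr rfl fun i _ ↦ Finset.sum_congr rfl fun j _ ↦ ?_
    ring
  rw [h3, h1, ← h2]
  push_cast
  ring

/-- The trace-reversed Einstein equations read `Ric = 8πG (T - g tr T / (n-1)) + 16πGΛ/(n-1) g`; on
a unit timelike vector the first part is nonnegative and the second is the constant. -/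
theorem ricci_lower_bound {G Λ : ℝ} (hn : 2 ≤ n) (hG : 0 < G) (hS : X.StrongEnergy G Λ) {p : M}
    (hp : p ∈ X.region) {k : TangentSpace (𝓡 (n + 1)) p} (hk : X.IsFutureTimelike p k)
    (hk1 : X.g.inner p k k = -1) :
    -(16 * Real.pi * G * Λ / ((n : ℝ) - 1)) ≤ X.g.ricci p k k := by
  have h := hS p hp k hk
  have hn1 : (0 : ℝ) < (n : ℝ) - 1 := by
    have : (2 : ℝ) ≤ n := by exact_mod_cast hn
    linarith
  rw [traceForm_stress, stress, hk1] at h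
  have hc : 0 < 8 * Real.pi * G := by positivity
  have key : X.g.ricci p k k + 16 * Real.pi * G * Λ / ((n : ℝ) - 1)
      = (8 * Real.pi * G) * ((8 * Real.pi * G)⁻¹ * (X.g.ricci p k k - X.g.scalar p / 2 * -1)
        + Λ * -1 - -1 * ((8 * Real.pi * G)⁻¹ * (X.g.scalar p - X.g.scalar p / 2 * (n + 1))
          + Λ * (n + 1)) / ((n : ℝ) - 1)) := by
    field_simp
    ring
  have := mul_nonneg hc.le h
  rw [← key] at this
  linarith

variable {S : Type*} [TopologicalSpace S] [ChartedSpace (Coord n) S]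

/-- The gradient of `t` is timelike and `g(∇t, ν) = dt(ν)`, so the sign chosen against the gradient
is the future direction. -/
theorem futureNormal_spec {y : S → M} {x : S} (hy : IsSpacelikeAt X.g y x) :
    X.g.inner (y x) (X.futureNormal y x) (X.futureNormal y x) = -1 ∧
      0 < differential X.t (y x) (X.futureNormal y x) ∧
      ∀ u : TangentSpace (𝓡 n) x,
        X.g.inner (y x) (X.futureNormal y x) (mfderiv (𝓡 n) (𝓡 (n + 1)) y x u) = 0 := by
  obtain ⟨ν, h1, h2, h3⟩ := (X.g.isLorentzForm (y x)).exists_normal (U := Coord n)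
    (A := mapDeriv y x) (by simp) hy (T := X.g.grad X.t (y x)) (X.t_temporal (y x))
  rw [X.g.form_grad] at h2
  exact Classical.epsilon_spec (p := fun ν : TangentSpace (𝓡 (n + 1)) (y x) ↦
    X.g.inner (y x) ν ν = -1 ∧ 0 < differential X.t (y x) ν ∧
      ∀ u : TangentSpace (𝓡 n) x, X.g.inner (y x) ν (mfderiv (𝓡 n) (𝓡 (n + 1)) y x u) = 0)
    ⟨ν, h1, h2, h3⟩

/-- Where the time function restricted to a spacelike hypersurface is critical, its derivative in
the normal direction is the inverse lapse. -/
theorem differential_futureNormal_eq_lapseInv {y : S → M} {x : S} (hy : IsSpacelikeAt X.g y x)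
    (hcrit : ∀ u : TangentSpace (𝓡 n) x,
      differential X.t (y x) (mfderiv (𝓡 n) (𝓡 (n + 1)) y x u) = 0) :
    differential X.t (y x) (X.futureNormal y x) = X.lapseInv (y x) := by
  obtain ⟨h1, h2, h3⟩ := X.futureNormal_spec hy
  have h := (X.g.isLorentzForm (y x)).inner_normal_of_gradient_normal (U := Coord n)
    (A := mapDeriv y x) (by simp) hy (T := X.g.grad X.t (y x)) (ν := X.futureNormal y x)
    (X.t_temporal (y x)) (fun u ↦ (X.g.form_grad _ _ _).trans (hcrit u)) h1
    (h2.trans_eq (X.g.form_grad _ _ _).symm) h3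
  exact (X.g.form_grad _ _ _).symm.trans h

end Cosmology

end Normals

/-! ### Maximum principle and a continuity criterion -/

section MaximumPrinciple

/-- A scalar maximum principle: a continuous function on a compact space times an interval that
starts negative and decreases in time at every spatial maximum where it is nonnegative stays
negative. -/
theorem neg_of_decreasing_at_max {S : Type*} [TopologicalSpace S] [CompactSpace S]
    {f : S × ℝ → ℝ} {T : ℝ} (hf : ContinuousOn f (univ ×ˢ Ico 0 T)) (h0 : ∀ x, f (x, 0) < 0)
    (hstep : ∀ x, ∀ s ∈ Ioo 0 T, 0 ≤ f (x, s) → (∀ x', f (x', s) ≤ f (x, s)) →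
      ∃ d < 0, HasDerivAt (fun s ↦ f (x, s)) d s) :
    ∀ x, ∀ s ∈ Ico 0 T, f (x, s) < 0 := by
  intro x s hs
  by_contra hx
  push Not at hx
  have hsub : (univ : Set S) ×ˢ Icc 0 s ⊆ univ ×ˢ Ico 0 T :=
    prod_mono le_rfl fun r hr ↦ ⟨hr.1, hr.2.trans_lt hs.2⟩
  have hcl : IsClosed ((univ : Set S) ×ˢ Icc 0 s ∩ f ⁻¹' Ici 0) :=
    (hf.mono hsub).preimage_isClosed_of_isClosed (isClosed_univ.prod isClosed_Icc) isClosed_Ici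
  have hcomp : IsCompact ((univ : Set S) ×ˢ Icc 0 s ∩ f ⁻¹' Ici 0) :=
    (isCompact_univ.prod isCompact_Icc).of_isClosed_subset hcl inter_subset_left
  -- By compactness there is a first time `s₁` at which `f` is nonnegative somewhere.
  obtain ⟨⟨x₁, s₁⟩, ⟨⟨-, hs₁⟩, hx₁⟩, hmin⟩ := hcomp.exists_isMinOn
    ⟨(x, s), ⟨⟨mem_univ _, hs.1, le_rfl⟩, hx⟩⟩ continuous_snd.continuousOn
  simp only [mem_Icc, mem_preimage, mem_Ici] at hs₁ hx₁
  have hpos : 0 < s₁ := by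
    rcases hs₁.1.eq_or_lt with h | h
    · rw [← h] at hx₁
      exact absurd hx₁ (h0 x₁).not_ge
    · exact h
  have hs₁T : s₁ < T := hs₁.2.trans_lt hs.2
  have hcont : Continuous fun x' ↦ f (x', s₁) := by
    rw [← continuousOn_univ]
    exact hf.comp (by fun_prop) fun x' _ ↦ ⟨mem_univ _, hpos.le, hs₁T⟩
  obtain ⟨x₂, -, hmax⟩ := isCompact_univ.exists_isMaxOn ⟨x₁, mem_univ x₁⟩ hcont.continuousOn
  have hmax' : ∀ x', f (x', s₁) ≤ f (x₂, s₁) := fun x' ↦ hmax (mem_univ x')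
  have hx₂ : 0 ≤ f (x₂, s₁) := hx₁.trans (hmax' x₁)
  obtain ⟨d, hd, hder⟩ := hstep x₂ s₁ ⟨hpos, hs₁T⟩ hx₂ hmax'
  -- A negative time derivative at the maximum `x₂` makes `f` larger just before `s₁`, so it would
  -- have been nonnegative earlier.
  have hslope : ∀ᶠ r in 𝓝[<] s₁, slope (fun s ↦ f (x₂, s)) s₁ r < 0 :=
    ((hasDerivAt_iff_tendsto_slope.mp hder).eventually (gt_mem_nhds hd)).filter_mono
      (nhdsWithin_mono _ fun r hr ↦ ne_of_lt hr)
  obtain ⟨r, hr, hr0, hrs⟩ := (hslope.and (Ioo_mem_nhdsLT hpos)).exists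
  rw [slope_def_field, div_neg_iff] at hr
  have hrpos : f (x₂, s₁) < f (x₂, r) := by
    rcases hr with hr | hr
    · linarith [hr.1]
    · linarith [hr.2]
  have := hmin (a := (x₂, r)) ⟨⟨mem_univ _, hr0.le, hrs.le.trans hs₁.2⟩, (hx₂.trans hrpos.le)⟩
  simp only [Set.mem_ofPred_eq] at this
  linarith

/-- A real function is continuous if its square and some function of the same sign are. -/
theorem continuousWithinAt_of_sq {Z : Type*} [TopologicalSpace Z] {k d : Z → ℝ} {s : Set Z} {z : Z}
    (hz : z ∈ s) (hk : ContinuousWithinAt (fun z ↦ k z ^ 2) s z) (hd : ContinuousWithinAt d s z)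
    (hpos : ∀ z ∈ s, 0 < d z ↔ 0 < k z) (hneg : ∀ z ∈ s, d z < 0 ↔ k z < 0) :
    ContinuousWithinAt k s z := by
  have habs : ContinuousWithinAt (fun z ↦ |k z|) s z := by
    have := Real.continuous_sqrt.continuousAt.comp_continuousWithinAt hk
    simpa [Function.comp_def, Real.sqrt_sq_eq_abs] using this
  -- Away from a zero the sign of `d` fixes the sign of `k` nearby; at a zero `|k| → 0` suffices.
  rcases lt_trichotomy (k z) 0 with h | h | h
  · refine (habs.neg).congr_of_eventuallyEq ?_ (by simp [abs_of_neg h])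
    filter_upwards [hd.eventually (gt_mem_nhds ((hneg z hz).mpr h)), self_mem_nhdsWithin]
      with w hw hws
    simp [abs_of_neg ((hneg w hws).mp hw)]
  · have h1 : Tendsto (fun z ↦ |k z|) (𝓝[s] z) (𝓝 0) := by
      simpa [ContinuousWithinAt, h] using habs
    rw [ContinuousWithinAt, h]
    exact (tendsto_zero_iff_abs_tendsto_zero _).mpr h1
  · refine habs.congr_of_eventuallyEq ?_ (by simp [abs_of_pos h])
    filter_upwards [hd.eventually (lt_mem_nhds ((hpos z hz).mpr h)), self_mem_nhdsWithin]
      with w hw hws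
    simp [abs_of_pos ((hpos w hws).mp hw)]

end MaximumPrinciple

/-! ### The flow in charts and continuity of the mean curvature -/

section FlowCharts

variable {n : ℕ} {M : Type*} [TopologicalSpace M] [ChartedSpace (Coord (n + 1)) M]
  [IsManifold (𝓡 (n + 1)) ∞ M] {S : Type*} [TopologicalSpace S] [ChartedSpace (Coord n) S]
  [IsManifold (𝓡 n) ∞ S]

/-- A family of maps of an `n`-manifold into the spacetime, in the preferred charts at `x` and
`q`. -/
def chartFamily (q : M) (x : S) (y : ℝ → S → M) (z : Coord n × ℝ) : Coord (n + 1) :=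
  chartMap q x (y z.2) z.1

theorem contDiffWithinAt_comp_chart {H : Type} [NormedAddCommGroup H] [NormedSpace ℝ H]
    {f : S × ℝ → H} {I : Set ℝ} {x : S} {a : Coord n} {s : ℝ}
    (ha : a ∈ (extChartAt (𝓡 n) x).target)
    (hf : ContMDiffWithinAt ((𝓡 n).prod 𝓘(ℝ, ℝ)) 𝓘(ℝ, H) ∞ f (univ ×ˢ I)
      ((extChartAt (𝓡 n) x).symm a, s)) :
    ContDiffWithinAt ℝ ∞ (fun z : Coord n × ℝ ↦ f ((extChartAt (𝓡 n) x).symm z.1, z.2))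
      (univ ×ˢ I) (a, s) := by
  rw [← contMDiffWithinAt_iff_contDiffWithinAt]
  have h1 : ContMDiffAt 𝓘(ℝ, Coord n) (𝓡 n) ∞ (extChartAt (𝓡 n) x).symm a :=
    (contMDiffOn_extChartAt_symm x).contMDiffAt ((isOpen_extChartAt_target x).mem_nhds ha)
  have h2 : ContMDiffAt 𝓘(ℝ, Coord n × ℝ) 𝓘(ℝ, Coord n) ∞ (Prod.fst : Coord n × ℝ → Coord n)
      (a, s) := contDiff_fst.contMDiff.contMDiffAt
  have h3 : ContMDiffAt 𝓘(ℝ, Coord n × ℝ) 𝓘(ℝ, ℝ) ∞ (Prod.snd : Coord n × ℝ → ℝ)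
      (a, s) := contDiff_snd.contMDiff.contMDiffAt
  have h4 : ContMDiffAt 𝓘(ℝ, Coord n × ℝ) ((𝓡 n).prod 𝓘(ℝ, ℝ)) ∞
      (fun z : Coord n × ℝ ↦ ((extChartAt (𝓡 n) x).symm z.1, z.2)) (a, s) :=
    (ContMDiffAt.comp (a, s) (g := (extChartAt (𝓡 n) x).symm) (f := Prod.fst) h1 h2).prodMk h3
  exact ContMDiffWithinAt.comp (a, s) hf h4.contMDiffWithinAt fun z hz ↦ ⟨mem_univ _, hz.2⟩

/-- At flow parameter `0` only a one-sided derivative is available, so velocities are read off from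
derivatives within the half-open strip. -/
theorem fderivWithin_time {H : Type} [NormedAddCommGroup H] [NormedSpace ℝ H]
    {f : Coord n × ℝ → H} {I : Set ℝ} {a : Coord n} {s : ℝ} {d : H}
    (hf : DifferentiableWithinAt ℝ f (univ ×ˢ I) (a, s)) (hI : UniqueDiffWithinAt ℝ I s)
    (hd : HasDerivWithinAt (fun s ↦ f (a, s)) d I s) :
    fderivWithin ℝ f (univ ×ˢ I) (a, s) (0, 1) = d := by
  have h1 : HasDerivWithinAt (fun s : ℝ ↦ (a, s)) ((0 : Coord n), (1 : ℝ)) I s :=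
    (hasDerivWithinAt_const s I a).prodMk (hasDerivWithinAt_id s I)
  have h2 := HasFDerivWithinAt.comp_hasDerivWithinAt s hf.hasFDerivWithinAt h1
    (fun r hr ↦ ⟨mem_univ _, hr⟩)
  exact hI.eq_deriv I h2 hd

/-- The future-directed unit normal, as a vector of the model space. -/
def Cosmology.normalVec (X : Cosmology n M) (y : S → M) (x : S) : Coord (n + 1) :=
  X.futureNormal y x

/-- The differential of the time function, as a covector of the model space. -/
def Cosmology.dt (X : Cosmology n M) (p : M) : Coord (n + 1) →L[ℝ] ℝ := differential X.t p

namespace Cosmology.IsMeanCurvatureFlow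

variable {X : Cosmology n M} {y : ℝ → S → M} {lam₀ : ℝ} (h : X.IsMeanCurvatureFlow y lam₀)
include h

theorem contMDiff_slice {s : ℝ} (hs : s ∈ Ico 0 lam₀) :
    ContMDiff (𝓡 n) (𝓡 (n + 1)) ∞ (y s) := by
  have h1 : ContMDiff (𝓡 n) ((𝓡 n).prod 𝓘(ℝ, ℝ)) ∞ (fun x : S ↦ (x, s)) :=
    contMDiff_id.prodMk contMDiff_const
  have h2 := h.smooth.comp h1.contMDiffOn (s := univ) fun x _ ↦ ⟨mem_univ _, hs⟩
  rwa [contMDiffOn_univ] at h2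

theorem contDiffWithinAt_chartFamily {q : M} {x : S} {a : Coord n} {s : ℝ}
    (ha : a ∈ (extChartAt (𝓡 n) x).target) (hs : s ∈ Ico 0 lam₀)
    (hq : y s ((extChartAt (𝓡 n) x).symm a) ∈ (extChartAt (𝓡 (n + 1)) q).source) :
    ContDiffWithinAt ℝ ∞ (chartFamily q x y) (univ ×ˢ Ico 0 lam₀) (a, s) := by
  have h1 := h.smooth ((extChartAt (𝓡 n) x).symm a, s) ⟨mem_univ _, hs⟩
  have h2 : ContMDiffAt (𝓡 (n + 1)) 𝓘(ℝ, Coord (n + 1)) ∞ (extChartAt (𝓡 (n + 1)) q)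
      (y s ((extChartAt (𝓡 n) x).symm a)) := contMDiffAt_extChartAt' (by simpa using hq)
  exact contDiffWithinAt_comp_chart (x := x)
    (f := fun z : S × ℝ ↦ extChartAt (𝓡 (n + 1)) q (y z.2 z.1)) ha
    (ContMDiffAt.comp_contMDiffWithinAt (g := extChartAt (𝓡 (n + 1)) q)
      (f := fun z : S × ℝ ↦ y z.2 z.1) _ h2 h1)

theorem contMDiffOn_height :
    ContMDiffOn ((𝓡 n).prod 𝓘(ℝ, ℝ)) 𝓘(ℝ, ℝ) ∞ (fun z : S × ℝ ↦ X.t (y z.2 z.1))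
      (univ ×ˢ Ico 0 lam₀) :=
  X.t_smooth.comp_contMDiffOn h.smooth

theorem hasDerivWithinAt_chartFamily {q : M} {x : S} {a : Coord n} {s : ℝ}
    (hs : s ∈ Ico 0 lam₀)
    (hq : y s ((extChartAt (𝓡 n) x).symm a) ∈ (extChartAt (𝓡 (n + 1)) q).source) :
    HasDerivWithinAt (fun s ↦ chartFamily q x y (a, s))
      (X.hypersurfaceK (y s) ((extChartAt (𝓡 n) x).symm a) •
        chartDeriv q (y s ((extChartAt (𝓡 n) x).symm a))
          (X.normalVec (y s) ((extChartAt (𝓡 n) x).symm a))) (Ico 0 lam₀) s := by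
  set x' := (extChartAt (𝓡 n) x).symm a
  have h2 : MDifferentiableAt (𝓡 (n + 1)) 𝓘(ℝ, Coord (n + 1)) (extChartAt (𝓡 (n + 1)) q)
      (y s x') := mdifferentiableAt_extChartAt (by simpa using hq)
  have h3 : HasFDerivWithinAt (fun s ↦ chartFamily q x y (a, s))
      ((chartDeriv q (y s x')).comp (ContinuousLinearMap.toSpanSingleton ℝ
        (X.hypersurfaceK (y s) x' • X.normalVec (y s) x'))) (Ico 0 lam₀) s :=
    (h2.hasMFDerivAt.comp_hasMFDerivWithinAt s (h.flow s hs x')).hasFDerivWithinAt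
  refine h3.hasDerivWithinAt.congr_deriv ?_
  rw [ContinuousLinearMap.comp_apply, ContinuousLinearMap.toSpanSingleton_apply, one_smul,
    map_smul]

theorem hasDerivWithinAt_height {s : ℝ} (hs : s ∈ Ico 0 lam₀) (x : S) :
    HasDerivWithinAt (fun s ↦ X.t (y s x))
      (X.hypersurfaceK (y s) x * X.dt (y s x) (X.normalVec (y s) x)) (Ico 0 lam₀) s := by
  have h2 : MDifferentiableAt (𝓡 (n + 1)) 𝓘(ℝ, ℝ) X.t (y s x) :=
    X.t_smooth.mdifferentiableAt (by simp)
  have h3 : HasFDerivWithinAt (fun s ↦ X.t (y s x))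
      ((X.dt (y s x)).comp (ContinuousLinearMap.toSpanSingleton ℝ
        (X.hypersurfaceK (y s) x • X.normalVec (y s) x))) (Ico 0 lam₀) s :=
    (h2.hasMFDerivAt.comp_hasMFDerivWithinAt s (h.flow s hs x)).hasFDerivWithinAt
  refine h3.hasDerivWithinAt.congr_deriv ?_
  rw [ContinuousLinearMap.comp_apply, ContinuousLinearMap.toSpanSingleton_apply, one_smul,
    map_smul, smul_eq_mul]

theorem coord_normal {q : M} {x : S} {s : ℝ} (hs : s ∈ Ico 0 lam₀)
    (hq : y s x ∈ (extChartAt (𝓡 (n + 1)) q).source) :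
    X.g.coord q (extChartAt (𝓡 (n + 1)) q (y s x))
      (chartDeriv q (y s x) (X.normalVec (y s) x))
      (chartDeriv q (y s x) (X.normalVec (y s) x)) = -1 :=
  (X.g.coord_chartDeriv hq _ _).trans (X.futureNormal_spec (h.spacelike s hs x)).1

/-- The flow equation and `g(n, n) = -1` give `K² = -g(∂y, ∂y)`, and `∂u = K dt(n)` with `dt(n) > 0`
has the sign of `K`. Both expressions are continuous without any regularity of the chosen normal. -/
theorem continuousOn_hypersurfaceK :
    ContinuousOn (fun z : S × ℝ ↦ X.hypersurfaceK (y z.2) z.1) (univ ×ˢ Ico 0 lam₀) := by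
  rintro ⟨x, s⟩ ⟨-, hs⟩
  set q := y s x with hq
  set a := extChartAt (𝓡 n) x x with ha
  set D : Set (Coord n × ℝ) := univ ×ˢ Ico 0 lam₀ with hD
  have hat : a ∈ (extChartAt (𝓡 n) x).target := mem_extChartAt_target x
  have hx : (extChartAt (𝓡 n) x).symm a = x := extChartAt_to_inv x
  have hqs : y s ((extChartAt (𝓡 n) x).symm a) ∈ (extChartAt (𝓡 (n + 1)) q).source := by
    rw [hx]; exact mem_extChartAt_source q
  have huI : ∀ r ∈ Ico 0 lam₀, UniqueDiffWithinAt ℝ (Ico 0 lam₀) r := uniqueDiffOn_Ico 0 lam₀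
  have hu : UniqueDiffOn ℝ D := uniqueDiffOn_univ.prod (uniqueDiffOn_Ico 0 lam₀)
  have hmem : (a, s) ∈ D := ⟨mem_univ _, hs⟩
  have hY := h.contDiffWithinAt_chartFamily hat hs hqs
  have hU : ContDiffWithinAt ℝ ∞
      (fun z : Coord n × ℝ ↦ X.t (y z.2 ((extChartAt (𝓡 n) x).symm z.1))) D (a, s) :=
    contDiffWithinAt_comp_chart hat
    (h.contMDiffOn_height ((extChartAt (𝓡 n) x).symm a, s) ⟨mem_univ _, hs⟩)
  have htime : ∀ {H : Type} [NormedAddCommGroup H] [NormedSpace ℝ H] {f : Coord n × ℝ → H},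
      ContDiffWithinAt ℝ ∞ f D (a, s) →
      ContinuousWithinAt (fun z ↦ fderivWithin ℝ f D z (0, 1)) D (a, s) := fun hf ↦
    ((hf.fderivWithin_right (m := 0) hu (by simp) hmem).continuousWithinAt).clm_apply
      continuousWithinAt_const
  have hz : chartFamily q x y (a, s) ∈ (extChartAt (𝓡 (n + 1)) q).target := by
    rw [chartFamily, chartMap]
    exact (extChartAt (𝓡 (n + 1)) q).map_source hqs
  have hGY : ContinuousWithinAt (fun z ↦ X.g.coord q (chartFamily q x y z)) D (a, s) :=
    (X.g.contDiffAt_coord hz).continuousAt.comp_continuousWithinAt hY.continuousWithinAt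
  have hsq : ContinuousWithinAt (fun z ↦ -X.g.coord q (chartFamily q x y z)
      (fderivWithin ℝ (chartFamily q x y) D z (0, 1))
      (fderivWithin ℝ (chartFamily q x y) D z (0, 1))) D (a, s) :=
    ((hGY.clm_apply (htime hY)).clm_apply (htime hY)).neg
  have hd := htime hU
  have hψ : ContinuousWithinAt (fun z : S × ℝ ↦ (extChartAt (𝓡 n) x z.1, z.2))
      (univ ×ˢ Ico 0 lam₀) (x, s) :=
    (ContinuousAt.prodMk
      (ContinuousAt.comp (g := extChartAt (𝓡 n) x) (f := Prod.fst) (x := (x, s))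
        (continuousAt_extChartAt x) continuousAt_fst) continuousAt_snd).continuousWithinAt
  have hmaps : MapsTo (fun z : S × ℝ ↦ (extChartAt (𝓡 n) x z.1, z.2)) (univ ×ˢ Ico 0 lam₀) D :=
    fun z hz ↦ ⟨mem_univ _, hz.2⟩
  have hsrc : ∀ᶠ z : S × ℝ in 𝓝[univ ×ˢ Ico 0 lam₀] (x, s),
      z.1 ∈ (extChartAt (𝓡 n) x).source ∧ z.2 ∈ Ico 0 lam₀ ∧
        y z.2 z.1 ∈ (extChartAt (𝓡 (n + 1)) q).source := by
    have hyc : ContinuousWithinAt (fun z : S × ℝ ↦ y z.2 z.1) (univ ×ˢ Ico 0 lam₀) (x, s) :=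
      (h.smooth (x, s) ⟨mem_univ _, hs⟩).continuousWithinAt
    filter_upwards [self_mem_nhdsWithin, mem_nhdsWithin_of_mem_nhds
      (continuousAt_fst.preimage_mem_nhds (extChartAt_source_mem_nhds (I := 𝓡 n) x)),
      hyc.preimage_mem_nhdsWithin (extChartAt_source_mem_nhds (I := 𝓡 (n + 1)) q)] with z h1 h2 h3
    exact ⟨h2, h1.2, h3⟩
  have hval : ∀ z : S × ℝ, z.1 ∈ (extChartAt (𝓡 n) x).source → z.2 ∈ Ico 0 lam₀ →
      y z.2 z.1 ∈ (extChartAt (𝓡 (n + 1)) q).source →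
      X.hypersurfaceK (y z.2) z.1 ^ 2
        = -X.g.coord q (chartFamily q x y (extChartAt (𝓡 n) x z.1, z.2))
          (fderivWithin ℝ (chartFamily q x y) D (extChartAt (𝓡 n) x z.1, z.2) (0, 1))
          (fderivWithin ℝ (chartFamily q x y) D (extChartAt (𝓡 n) x z.1, z.2) (0, 1)) := by
    rintro ⟨x', r⟩ h1 h2 h3
    simp only at h1 h2 h3 ⊢
    have hx' : (extChartAt (𝓡 n) x).symm (extChartAt (𝓡 n) x x') = x' :=
      (extChartAt (𝓡 n) x).left_inv h1
    have ht := (extChartAt (𝓡 n) x).map_source h1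
    have h3' : y r ((extChartAt (𝓡 n) x).symm (extChartAt (𝓡 n) x x'))
        ∈ (extChartAt (𝓡 (n + 1)) q).source := by rwa [hx']
    rw [fderivWithin_time ((h.contDiffWithinAt_chartFamily ht h2 h3').differentiableWithinAt
      (by simp)) (huI r h2) (h.hasDerivWithinAt_chartFamily h2 h3'), chartFamily, chartMap]
    simp only [hx', map_smul, smul_apply, smul_eq_mul]
    rw [h.coord_normal h2 h3]
    ring
  have hval' : ∀ z : S × ℝ, z.1 ∈ (extChartAt (𝓡 n) x).source → z.2 ∈ Ico 0 lam₀ →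
      X.hypersurfaceK (y z.2) z.1 * X.dt (y z.2 z.1) (X.normalVec (y z.2) z.1)
        = fderivWithin ℝ (fun z : Coord n × ℝ ↦ X.t (y z.2 ((extChartAt (𝓡 n) x).symm z.1))) D
          (extChartAt (𝓡 n) x z.1, z.2) (0, 1) := by
    rintro ⟨x', r⟩ h1 h2
    simp only at h1 h2 ⊢
    have hx' : (extChartAt (𝓡 n) x).symm (extChartAt (𝓡 n) x x') = x' :=
      (extChartAt (𝓡 n) x).left_inv h1
    have ht := (extChartAt (𝓡 n) x).map_source h1
    have hUr : ContDiffWithinAt ℝ ∞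
        (fun z : Coord n × ℝ ↦ X.t (y z.2 ((extChartAt (𝓡 n) x).symm z.1))) D
        (extChartAt (𝓡 n) x x', r) := contDiffWithinAt_comp_chart ht (h.contMDiffOn_height ((extChartAt (𝓡 n) x).symm (extChartAt (𝓡 n) x x'), r) ⟨mem_univ _, h2⟩)
    rw [fderivWithin_time (hUr.differentiableWithinAt (by simp)) (huI r h2)
      (h.hasDerivWithinAt_height h2 ((extChartAt (𝓡 n) x).symm (extChartAt (𝓡 n) x x'))), hx']
  have hsign : ∀ z ∈ (univ : Set S) ×ˢ Ico 0 lam₀,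
      0 < X.dt (y z.2 z.1) (X.normalVec (y z.2) z.1) := fun z hz ↦
    (X.futureNormal_spec (h.spacelike z.2 hz.2 z.1)).2.1
  have hsq' := ContinuousWithinAt.comp (f := fun z : S × ℝ ↦ (extChartAt (𝓡 n) x z.1, z.2))
    (x := (x, s)) hsq hψ hmaps
  have hd' := ContinuousWithinAt.comp (f := fun z : S × ℝ ↦ (extChartAt (𝓡 n) x z.1, z.2))
    (x := (x, s)) hd hψ hmaps
  refine continuousWithinAt_of_sq (d := fun z ↦ X.hypersurfaceK (y z.2) z.1 *
    X.dt (y z.2 z.1) (X.normalVec (y z.2) z.1)) ⟨mem_univ _, hs⟩ ?_ ?_ ?_ ?_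
  · refine hsq'.congr_of_eventuallyEq ?_ (hval (x, s) (mem_extChartAt_source x) hs
        (mem_extChartAt_source q))
    filter_upwards [hsrc] with z hz using hval z hz.1 hz.2.1 hz.2.2
  · refine hd'.congr_of_eventuallyEq ?_ (hval' (x, s) (mem_extChartAt_source x) hs)
    filter_upwards [hsrc] with z hz using hval' z hz.1 hz.2.1
  · exact fun z hz ↦ mul_pos_iff_of_pos_right (hsign z hz)
  · exact fun z hz ↦ by rw [← neg_pos, ← neg_mul, mul_pos_iff_of_pos_right (hsign z hz), neg_pos]

end Cosmology.IsMeanCurvatureFlow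

end FlowCharts

/-! ### Decrease of the mean curvature above `K_Λ` -/

section SpeedDecrease

variable {n : ℕ} {M : Type*} [TopologicalSpace M] [ChartedSpace (Coord (n + 1)) M]
  [IsManifold (𝓡 (n + 1)) ∞ M] {S : Type*} [TopologicalSpace S] [ChartedSpace (Coord n) S]
  [IsManifold (𝓡 n) ∞ S]

theorem LorentzMetric.ricci_eq (g : LorentzMetric (n + 1) M) (p : M) (v w : Coord (n + 1)) :
    g.ricci p v w
      = ∑ i, (curv (g.coord p) (extChartAt (𝓡 (n + 1)) p p) (stdVec i) v w) i := by
  simp only [← LorentzMetric.riemann_eq]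
  rfl

theorem mul_eq_KLam_sq {G Λ : ℝ} (hn : 2 ≤ n) (hG : 0 < G) (hΛ : 0 < Λ) :
    n * (16 * Real.pi * G * Λ / ((n : ℝ) - 1)) = KLam n G Λ ^ 2 := by
  have hn1 : (0 : ℝ) < (n : ℝ) - 1 := by
    have : (2 : ℝ) ≤ n := by exact_mod_cast hn
    linarith
  have hpi := Real.pi_pos
  rw [KLam, Real.sq_sqrt (by positivity)]
  ring

namespace Cosmology.IsMeanCurvatureFlow

variable {X : Cosmology n M} {y : ℝ → S → M} {lam₀ : ℝ} (h : X.IsMeanCurvatureFlow y lam₀)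
include h

theorem contDiffAt_chartFamily {q : M} {x : S} {a : Coord n} {s : ℝ}
    (ha : a ∈ (extChartAt (𝓡 n) x).target) (hs : s ∈ Ioo 0 lam₀)
    (hq : y s ((extChartAt (𝓡 n) x).symm a) ∈ (extChartAt (𝓡 (n + 1)) q).source) :
    ContDiffAt ℝ ∞ (chartFamily q x y) (a, s) :=
  (h.contDiffWithinAt_chartFamily ha (Ioo_subset_Ico_self hs) hq).contDiffAt
    (prod_mem_nhds univ_mem (Ico_mem_nhds hs.1 hs.2))

theorem fderiv_chartFamily_time {q : M} {x : S} {a : Coord n} {s : ℝ}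
    (ha : a ∈ (extChartAt (𝓡 n) x).target) (hs : s ∈ Ioo 0 lam₀)
    (hq : y s ((extChartAt (𝓡 n) x).symm a) ∈ (extChartAt (𝓡 (n + 1)) q).source) :
    fderiv ℝ (chartFamily q x y) (a, s) (0, 1)
      = X.hypersurfaceK (y s) ((extChartAt (𝓡 n) x).symm a) •
        chartDeriv q (y s ((extChartAt (𝓡 n) x).symm a))
          (X.normalVec (y s) ((extChartAt (𝓡 n) x).symm a)) := by
  have hs' := Ioo_subset_Ico_self hs
  rw [← fderivWithin_of_mem_nhds (s := univ ×ˢ Ico 0 lam₀)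
    (prod_mem_nhds univ_mem (Ico_mem_nhds hs.1 hs.2))]
  exact fderivWithin_time ((h.contDiffWithinAt_chartFamily ha hs' hq).differentiableWithinAt
    (by simp)) (uniqueDiffOn_Ico 0 lam₀ s hs') (h.hasDerivWithinAt_chartFamily hs' hq)

theorem fderiv_chartFamily_space {q : M} {x : S} {a : Coord n} {s : ℝ}
    (ha : a ∈ (extChartAt (𝓡 n) x).target) (hs : s ∈ Ioo 0 lam₀)
    (hq : y s ((extChartAt (𝓡 n) x).symm a) ∈ (extChartAt (𝓡 (n + 1)) q).source) (u : Coord n) :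
    fderiv ℝ (chartFamily q x y) (a, s) (u, 0)
      = chartDeriv q (y s ((extChartAt (𝓡 n) x).symm a))
        (mapDeriv (y s) ((extChartAt (𝓡 n) x).symm a) (chartSymmDeriv x a u)) := by
  rw [← fderiv_slice ((h.contDiffAt_chartFamily ha hs hq).differentiableAt (by simp))]
  exact fderiv_chartMap ha ((h.contMDiff_slice (Ioo_subset_Ico_self hs)).mdifferentiable
    (by simp) _) hq u

theorem eventually_chart {q : M} {x : S} {s : ℝ} (hs : s ∈ Ioo 0 lam₀)
    (hq : y s x ∈ (extChartAt (𝓡 (n + 1)) q).source) (hK : 0 < X.hypersurfaceK (y s) x) :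
    ∀ᶠ z : Coord n × ℝ in 𝓝 (extChartAt (𝓡 n) x x, s),
      z.1 ∈ (extChartAt (𝓡 n) x).target ∧ z.2 ∈ Ioo 0 lam₀ ∧
        y z.2 ((extChartAt (𝓡 n) x).symm z.1) ∈ (extChartAt (𝓡 (n + 1)) q).source ∧
        0 < X.hypersurfaceK (y z.2) ((extChartAt (𝓡 n) x).symm z.1) := by
  have hx : (extChartAt (𝓡 n) x).symm (extChartAt (𝓡 n) x x) = x := extChartAt_to_inv x
  have hmem : (univ : Set S) ×ˢ Ico 0 lam₀ ∈ 𝓝 (x, s) :=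
    prod_mem_nhds univ_mem (Ico_mem_nhds hs.1 hs.2)
  have hψ : Tendsto (fun z : Coord n × ℝ ↦ ((extChartAt (𝓡 n) x).symm z.1, z.2))
      (𝓝 (extChartAt (𝓡 n) x x, s)) (𝓝 (x, s)) := by
    have h1 : ContinuousAt (fun z : Coord n × ℝ ↦ (extChartAt (𝓡 n) x).symm z.1)
        (extChartAt (𝓡 n) x x, s) :=
      ContinuousAt.comp (g := (extChartAt (𝓡 n) x).symm) (f := Prod.fst)
        (continuousAt_extChartAt_symm x) continuousAt_fst
    have h2 := h1.prodMk continuousAt_snd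
    rwa [ContinuousAt, hx] at h2
  have hy : ContinuousAt (fun z : S × ℝ ↦ y z.2 z.1) (x, s) :=
    (h.smooth.continuousOn).continuousAt hmem
  have hk : ContinuousAt (fun z : S × ℝ ↦ X.hypersurfaceK (y z.2) z.1) (x, s) :=
    h.continuousOn_hypersurfaceK.continuousAt hmem
  have h1 : ∀ᶠ z : S × ℝ in 𝓝 (x, s), y z.2 z.1 ∈ (extChartAt (𝓡 (n + 1)) q).source :=
    hy.preimage_mem_nhds ((isOpen_extChartAt_source q).mem_nhds hq)
  have h2 : ∀ᶠ z : S × ℝ in 𝓝 (x, s), 0 < X.hypersurfaceK (y z.2) z.1 :=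
    hk.eventually (lt_mem_nhds hK)
  filter_upwards [prod_mem_nhds (extChartAt_target_mem_nhds (I := 𝓡 n) x)
    (Ioo_mem_nhds hs.1 hs.2), hψ.eventually h1, hψ.eventually h2] with z h3 h4 h5
  exact ⟨h3.1, h3.2, h4, h5⟩

/-- At a spatial maximum that exceeds `K_Λ`, the mean curvature decreases along the flow. -/
theorem hasDerivAt_hypersurfaceK_neg {G Λ : ℝ} (hn : 2 ≤ n) (hG : 0 < G) (hΛ : 0 < Λ)
    (hS : X.StrongEnergy G Λ) {x : S} {s : ℝ} (hs : s ∈ Ioo 0 lam₀)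
    (hmax : ∀ x', X.hypersurfaceK (y s) x' ≤ X.hypersurfaceK (y s) x)
    (hK : KLam n G Λ < X.hypersurfaceK (y s) x) :
    ∃ d < 0, HasDerivAt (fun s ↦ X.hypersurfaceK (y s) x) d s := by
  have hKpos : 0 < X.hypersurfaceK (y s) x := (Real.sqrt_nonneg _).trans_lt hK
  have hs' := Ioo_subset_Ico_self hs
  set q := y s x with hqdef
  set a := extChartAt (𝓡 n) x x with ha
  have hx : (extChartAt (𝓡 n) x).symm a = x := extChartAt_to_inv x
  have hat : a ∈ (extChartAt (𝓡 n) x).target := mem_extChartAt_target x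
  have hq0 : y s x ∈ (extChartAt (𝓡 (n + 1)) q).source := mem_extChartAt_source q
  have hqs : y s ((extChartAt (𝓡 n) x).symm a) ∈ (extChartAt (𝓡 (n + 1)) q).source := by
    rwa [hx]
  let Y : Coord n × ℝ → Coord (n + 1) := chartFamily q x y
  let W : Coord n × ℝ → Coord (n + 1) := fun z ↦ fderiv ℝ Y z (0, 1)
  -- Where `K > 0`, the length of the velocity `W` is `K` and the normalized velocity is the future
  -- normal, which exhibits both as twice differentiable.
  let k : Coord n × ℝ → ℝ := fun z ↦ √(-(X.g.coord q (Y z) (W z) (W z)))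
  let N : Coord n × ℝ → Coord (n + 1) := fun z ↦ (k z)⁻¹ • W z
  have hYz : ∀ z, Y z = extChartAt (𝓡 (n + 1)) q (y z.2 ((extChartAt (𝓡 n) x).symm z.1)) :=
    fun _ ↦ rfl
  have hYa : Y (a, s) = extChartAt (𝓡 (n + 1)) q q := by rw [hYz]; simp only [hx, hqdef]
  have hzt : Y (a, s) ∈ (extChartAt (𝓡 (n + 1)) q).target := by
    rw [hYa]; exact mem_extChartAt_target q
  have hev := h.eventually_chart hs hq0 hKpos
  have hval : ∀ z : Coord n × ℝ, z.1 ∈ (extChartAt (𝓡 n) x).target → z.2 ∈ Ioo 0 lam₀ →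
      y z.2 ((extChartAt (𝓡 n) x).symm z.1) ∈ (extChartAt (𝓡 (n + 1)) q).source →
      0 < X.hypersurfaceK (y z.2) ((extChartAt (𝓡 n) x).symm z.1) →
      k z = X.hypersurfaceK (y z.2) ((extChartAt (𝓡 n) x).symm z.1) ∧
      N z = chartDeriv q (y z.2 ((extChartAt (𝓡 n) x).symm z.1))
        (X.normalVec (y z.2) ((extChartAt (𝓡 n) x).symm z.1)) ∧ W z = k z • N z := by
    rintro ⟨a', r⟩ h1 h2 h3 h4
    have hW : W (a', r) = _ := h.fderiv_chartFamily_time h1 h2 h3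
    have hn1 := h.coord_normal (Ioo_subset_Ico_self h2) h3
    have hk : k (a', r) = X.hypersurfaceK (y r) ((extChartAt (𝓡 n) x).symm a') := by
      simp only [k, hW, hYz, map_smul, smul_apply, smul_eq_mul, hn1]
      rw [show ∀ c : ℝ, -(c * (c * -1)) = c ^ 2 by intro c; ring, Real.sqrt_sq h4.le]
    have hN : N (a', r) = chartDeriv q (y r ((extChartAt (𝓡 n) x).symm a'))
        (X.normalVec (y r) ((extChartAt (𝓡 n) x).symm a')) := by
      simp only [N, hk, hW]
      exact inv_smul_smul₀ h4.ne' _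
    exact ⟨hk, hN, by rw [hN, hk, hW]⟩
  have h3' : ∀ m : ℕ, ((m : ℕ∞) : WithTop ℕ∞) ≤ ∞ := fun m ↦ WithTop.coe_le_coe.mpr le_top
  have hY : ContDiffAt ℝ ∞ Y (a, s) := h.contDiffAt_chartFamily hat hs hqs
  have hW : ContDiffAt ℝ 2 W (a, s) :=
    ((hY.of_le (h3' 3)).fderiv_right (m := 2) (by norm_num)).clm_apply contDiffAt_const
  have hGY : ContDiffAt ℝ 2 (fun z ↦ X.g.coord q (Y z)) (a, s) :=
    ((X.g.contDiffAt_coord hzt).of_le (h3' 2)).comp (a, s) (hY.of_le (h3' 2))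
  have hka := (hval (a, s) hat hs hqs (by simpa only [hx] using hKpos)).1
  have hkpos : 0 < k (a, s) := by rw [hka]; simpa only [hx] using hKpos
  have hk2 : ContDiffAt ℝ 2 k (a, s) :=
    ((hGY.clm_apply hW).clm_apply hW).neg.sqrt (Real.sqrt_pos.mp hkpos).ne'
  have hflow : NormalFlowAt (X.g.coord q) Y N k (range fun u : Coord n ↦ (u, (0 : ℝ))) (0, 1)
      (a, s) := by
    refine ⟨hY.of_le (h3' 3), (hk2.inv hkpos.ne').smul hW, hk2,
      (X.g.contDiffAt_coord hzt).of_le (h3' 3), .of_forall (X.g.coord_symm q),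
      (X.g.isLorentzForm_coord hzt).isInvertible, ?_, ?_, ?_⟩
    · filter_upwards [hev] with z ⟨h1, h2, h3, h4⟩
      rw [(hval z h1 h2 h3 h4).2.1]
      exact h.coord_normal (Ioo_subset_Ico_self h2) h3
    · filter_upwards [hev] with z ⟨h1, h2, h3, h4⟩
      rintro - ⟨u, rfl⟩
      rw [(hval z h1 h2 h3 h4).2.1]
      refine (congrArg _ (h.fderiv_chartFamily_space h1 h2 h3 u)).trans ?_
      rw [hYz, X.g.coord_chartDeriv h3]
      exact (X.futureNormal_spec (h.spacelike z.2 (Ioo_subset_Ico_self h2) _)).2.2 _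
    · filter_upwards [hev] with z ⟨h1, h2, h3, h4⟩ using (hval z h1 h2 h3 h4).2.2
  have hline : ∀ᶠ r in 𝓝 s, r ∈ Ioo 0 lam₀ ∧ y r x ∈ (extChartAt (𝓡 (n + 1)) q).source ∧
      0 < X.hypersurfaceK (y r) x := by
    have hc : Tendsto (fun r : ℝ ↦ (a, r)) (𝓝 s) (𝓝 (a, s)) := by
      exact (Continuous.prodMk_right a).tendsto s
    filter_upwards [hc.eventually hev] with r ⟨_, h2, h3, h4⟩
    simp only [hx] at h3 h4
    exact ⟨h2, h3, h4⟩
  have hline' : ∀ᶠ r in 𝓝 s, k (a, r) = X.hypersurfaceK (y r) x := by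
    filter_upwards [hline] with r ⟨h1, h2, h3⟩
    have := (hval (a, r) hat h1 (by rwa [hx]) (by rwa [hx])).1
    rwa [hx] at this
  have hNa : N (a, s) = X.normalVec (y s) x := by
    have := (hval (a, s) hat hs hqs (by simpa only [hx] using hKpos)).2.1
    simp only [hx, ← hqdef, chartDeriv_self] at this
    exact this
  suffices hk' : ∃ d < 0, HasDerivAt (fun r ↦ k (a, r)) d s by
    obtain ⟨d, hd, hder⟩ := hk'
    exact ⟨d, hd, hder.congr_of_eventuallyEq (hline'.mono fun r hr ↦ hr.symm)⟩
  refine hasDerivAt_speed_neg_of_isLocalMax (by omega) hflow ?_ ?_ ?_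
    (c := 16 * Real.pi * G * Λ / ((n : ℝ) - 1)) ?_ hkpos ?_
  · intro u hu
    change 0 < X.g.coord q (Y (a, s)) (fderiv ℝ (chartFamily q x y) (a, s) (u, 0))
      (fderiv ℝ (chartFamily q x y) (a, s) (u, 0))
    rw [h.fderiv_chartFamily_space hat hs hqs, hYz, X.g.coord_chartDeriv hqs]
    simp only [hx]
    rw [ha, chartSymmDeriv_self]
    exact h.spacelike s hs' x u hu
  -- Only the point `x` is followed in time, so its preferred chart on `S` does not change; the
  -- spacetime chart is held at `q`.
  · filter_upwards [hline, hline'] with r ⟨h1, h2, h3⟩ h4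
    have hN := (hval (a, r) hat h1 (by rwa [hx]) (by rwa [hx])).2.1
    simp only [hx] at hN
    rw [h4, hN]
    exact meanCurvature_eq X.g ((h.contMDiff_slice (Ioo_subset_Ico_self h1)).contMDiffAt) h2 _
  · have hc : Tendsto (fun a' : Coord n ↦ (a', s)) (𝓝 a) (𝓝 (a, s)) := by
      exact (Continuous.prodMk_left s).tendsto a
    filter_upwards [hc.eventually hev] with a' ⟨h1, h2, h3, h4⟩
    rw [(hval (a', s) h1 h2 h3 h4).1, hka]
    simp only [hx]
    exact hmax _
  · obtain ⟨hn1, hn2, -⟩ := X.futureNormal_spec (h.spacelike s hs' x)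
    have hr := X.ricci_lower_bound hn hG hS (h.mapsTo s hs' x)
      (k := X.futureNormal (y s) x) ⟨by rw [hn1]; norm_num, hn2⟩ hn1
    rw [hYa, hNa]
    exact hr.trans_eq (X.g.ricci_eq _ _ _)
  · rw [hka, mul_eq_KLam_sq hn hG hΛ]
    simp only [hx]
    exact pow_lt_pow_left₀ hK (Real.sqrt_nonneg _) two_ne_zero

end Cosmology.IsMeanCurvatureFlow

end SpeedDecrease

/-! ### Bounds on the mean curvature and on the height -/

section Bounds

variable {n : ℕ} {M : Type*} [TopologicalSpace M] [ChartedSpace (Coord (n + 1)) M]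
  [IsManifold (𝓡 (n + 1)) ∞ M] {S : Type*} [TopologicalSpace S] [ChartedSpace (Coord n) S]
  [IsManifold (𝓡 n) ∞ S]

/-- The time function is critical along a hypersurface where it is maximal. -/
theorem Cosmology.dt_mapDeriv_eq_zero (X : Cosmology n M) {y : S → M} {x : S}
    (hy : MDifferentiableAt (𝓡 n) (𝓡 (n + 1)) y x) (hmax : ∀ x', X.t (y x') ≤ X.t (y x))
    (u : Coord n) : X.dt (y x) (mapDeriv y x u) = 0 := by
  set a := extChartAt (𝓡 n) x x with ha
  have hx : (extChartAt (𝓡 n) x).symm a = x := extChartAt_to_inv x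
  have h1 : MDifferentiableAt 𝓘(ℝ, Coord n) (𝓡 n) (extChartAt (𝓡 n) x).symm a :=
    mdifferentiableAt_extChartAt_symm (mem_extChartAt_target x)
  have h2 : MDifferentiableAt (𝓡 (n + 1)) 𝓘(ℝ, ℝ) X.t (y x) :=
    X.t_smooth.mdifferentiableAt (by simp)
  have h3 := mfderiv_comp a (g := y) (f := (extChartAt (𝓡 n) x).symm) (by rwa [hx]) h1
  have h4 := mfderiv_comp a (g := X.t) (f := y ∘ (extChartAt (𝓡 n) x).symm)
    (by rwa [Function.comp_apply, hx]) (MDifferentiableAt.comp a (by rwa [hx]) h1)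
  have hloc : IsLocalMax (X.t ∘ y ∘ (extChartAt (𝓡 n) x).symm) a :=
    .of_forall fun a' ↦ by simpa only [Function.comp_apply, hx] using hmax _
  rw [mfderiv_eq_fderiv, h3, hloc.fderiv_eq_zero] at h4
  have h5 : 0 = X.dt (y ((extChartAt (𝓡 n) x).symm a))
      (mapDeriv y ((extChartAt (𝓡 n) x).symm a) (chartSymmDeriv x a u)) := by
    rw [chartSymmDeriv_eq_mfderiv]
    exact DFunLike.congr_fun h4 u
  rw [hx, ha, chartSymmDeriv_self] at h5
  exact h5.symm

theorem Cosmology.lapseInv_nonneg (X : Cosmology n M) (p : M) : 0 ≤ X.lapseInv p :=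
  Real.sqrt_nonneg _

namespace Cosmology.IsMeanCurvatureFlow

variable {X : Cosmology n M} {y : ℝ → S → M} {lam₀ : ℝ} (h : X.IsMeanCurvatureFlow y lam₀)
include h

theorem bddAbove_hypersurfaceK [CompactSpace S] {s : ℝ} (hs : s ∈ Ico 0 lam₀) :
    BddAbove (range (X.hypersurfaceK (y s))) := by
  refine (isCompact_range ?_).bddAbove
  rw [← continuousOn_univ]
  exact h.continuousOn_hypersurfaceK.comp (f := fun x : S ↦ (x, s)) (by fun_prop)
    fun x _ ↦ ⟨mem_univ _, hs⟩

theorem bddAbove_height [CompactSpace S] {s : ℝ} (hs : s ∈ Ico 0 lam₀) :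
    BddAbove (range fun x ↦ X.t (y s x)) :=
  (isCompact_range (X.t_smooth.continuous.comp (h.contMDiff_slice hs).continuous)).bddAbove

/-- Along the flow the mean curvature does not exceed its initial supremum and `K_Λ`. -/
theorem hypersurfaceK_le [CompactSpace S] {G Λ : ℝ} (hn : 2 ≤ n) (hG : 0 < G) (hΛ : 0 < Λ)
    (hS : X.StrongEnergy G Λ) {s : ℝ} (hs : s ∈ Ico 0 lam₀) (x : S) :
    X.hypersurfaceK (y s) x ≤ max (⨆ x', X.hypersurfaceK (y 0) x') (KLam n G Λ) := by
  set B := max (⨆ x', X.hypersurfaceK (y 0) x') (KLam n G Λ) with hB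
  have h0 : (0 : ℝ) ∈ Ico 0 lam₀ := ⟨le_rfl, hs.1.trans_lt hs.2⟩
  -- The slack `ε` makes the test function negative initially and forces `K > K_Λ` wherever it is
  -- nonnegative.
  refine le_of_forall_pos_le_add fun ε hε ↦ ?_
  have := neg_of_decreasing_at_max (f := fun z : S × ℝ ↦ X.hypersurfaceK (y z.2) z.1 - (B + ε))
    (h.continuousOn_hypersurfaceK.sub continuousOn_const) (fun x ↦ ?_) (fun x s hs hf hmax ↦ ?_)
    x s hs
  · simp only at this
    linarith
  · have := (le_ciSup (h.bddAbove_hypersurfaceK h0) x).trans (le_max_left _ (KLam n G Λ))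
    simp only
    linarith
  · simp only at hf hmax
    obtain ⟨d, hd, hder⟩ := h.hasDerivAt_hypersurfaceK_neg hn hG hΛ hS (x := x) hs
      (fun x' ↦ by linarith [hmax x'])
      (by linarith [le_max_right (⨆ x', X.hypersurfaceK (y 0) x') (KLam n G Λ)])
    exact ⟨d, hd, hder.sub_const _⟩

/-- The height grows at most linearly along the flow. -/
theorem height_le [CompactSpace S] {A B : ℝ} (hB : 0 ≤ B)
    (hA : ∀ s ∈ Ico 0 lam₀, ∀ x, X.lapseInv (y s x) ≤ A)
    (hK : ∀ s ∈ Ico 0 lam₀, ∀ x, X.hypersurfaceK (y s) x ≤ B) {s : ℝ} (hs : s ∈ Ico 0 lam₀)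
    (x : S) : X.t (y s x) ≤ (⨆ x', X.t (y 0 x')) + A * B * s := by
  set U := ⨆ x', X.t (y 0 x')
  have h0 : (0 : ℝ) ∈ Ico 0 lam₀ := ⟨le_rfl, hs.1.trans_lt hs.2⟩
  have hs1 : 0 < 1 + s := by linarith [hs.1]
  refine le_of_forall_pos_le_add fun ε hε ↦ ?_
  -- In `δ (1 + s)` the constant part gives strictness at time `0` and the linear part a strictly
  -- negative derivative; this `δ` makes the total slack at the given time equal to `ε`.
  set δ := ε / (1 + s) with hδ
  have hδpos : 0 < δ := by positivity
  have hδε : δ * (1 + s) = ε := div_mul_cancel₀ _ hs1.ne'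
  have := neg_of_decreasing_at_max
    (f := fun z : S × ℝ ↦ X.t (y z.2 z.1) - (U + A * B * z.2 + δ * (1 + z.2)))
    (h.contMDiffOn_height.continuousOn.sub (by fun_prop)) (fun x ↦ ?_)
    (fun x s hs _ hmax ↦ ?_) x s hs
  · simp only at this
    linarith
  · have := le_ciSup (h.bddAbove_height h0) x
    simp only at this ⊢
    linarith
  · simp only at hmax
    have hs' := Ioo_subset_Ico_self hs
    have hcrit : X.dt (y s x) (X.normalVec (y s) x) = X.lapseInv (y s x) :=
      X.differential_futureNormal_eq_lapseInv (h.spacelike s hs' x) fun u ↦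
        X.dt_mapDeriv_eq_zero ((h.contMDiff_slice hs').mdifferentiable (by simp) x)
          (fun x' ↦ by linarith [hmax x']) u
    have h1 := (h.hasDerivWithinAt_height hs' x).hasDerivAt (Ico_mem_nhds hs.1 hs.2)
    rw [hcrit] at h1
    have h2 : HasDerivAt (fun s : ℝ ↦ U + A * B * s + δ * (1 + s)) (A * B + δ) s := by
      have h3 := ((hasDerivAt_id s).const_mul (A * B)).const_add U
      have h4 := ((hasDerivAt_id s).const_add 1).const_mul δ
      exact (h3.add h4).congr_deriv (by simp)
    refine ⟨_, ?_, h1.sub h2⟩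
    -- Since `K` may be negative, `K ≤ B` is first multiplied by `N⁻¹ ≥ 0`, and only then `N⁻¹ ≤ A`
    -- by `B ≥ 0`.
    have h5 := mul_le_mul_of_nonneg_right (hK s hs' x) (X.lapseInv_nonneg (y s x))
    have h6 := mul_le_mul_of_nonneg_left (hA s hs' x) hB
    linarith [mul_comm A B]

end Cosmology.IsMeanCurvatureFlow

end Bounds

end CosmologyFlow

end

/-! ### The height bound -/

theorem theorem4 (n : ℕ) (hn : 2 ≤ n) (G Λ : ℝ) (hG : 0 < G) (hΛ : 0 < Λ) :
    ∃ C : ℝ → ℝ → ℝ,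
      (∀ A B, 0 ≤ C A B) ∧
      (∀ A B, 0 ≤ A → CosmologyFlow.KLam n G Λ ≤ B → C A B = A * B) ∧
      ∀ (M : Type*) [TopologicalSpace M] [T2Space M] [SecondCountableTopology M]
        [ConnectedSpace M] [ChartedSpace (CosmologyFlow.Coord (n + 1)) M]
        [IsManifold (𝓡 (n + 1)) ∞ M]
        (X : CosmologyFlow.Cosmology n M),
        X.DominantEnergy G Λ → X.StrongEnergy G Λ →
        ∀ (𝒩 : Set M) (τ : M → ℝ) (c₀ : ℝ), X.CrushingOnly 𝒩 τ c₀ →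
        ∀ (c : ℝ), c₀ < c →
        ∀ (S : Type*) [TopologicalSpace S] [T2Space S] [CompactSpace S]
          [ChartedSpace (CosmologyFlow.Coord n) S] [IsManifold (𝓡 n) ∞ S]
          (y : ℝ → S → M) (lam₀ : ℝ), 0 < lam₀ →
        X.IsMeanCurvatureFlow y lam₀ →
        (∀ lam ∈ Ico 0 lam₀, ∀ x, τ (y lam x) < c) →
        (∀ x, ∀ lam ∈ Ico 0 lam₀,
          X.t (y lam x) ≤ (⨆ x', X.t (y 0 x'))
            + C (sSup (X.lapseInv '' (X.region ∩ {p | τ p ≤ c})))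
                (⨆ x', X.hypersurfaceK (y 0) x') * lam) ∧
        (∀ x q, Tendsto (fun lam ↦ y lam x) (𝓝[<] lam₀) (𝓝 q) →
          X.t q ≤ (⨆ x', X.t (y 0 x'))
            + C (sSup (X.lapseInv '' (X.region ∩ {p | τ p ≤ c})))
                (⨆ x', X.hypersurfaceK (y 0) x') * lam₀) := by
  have hK0 : 0 ≤ CosmologyFlow.KLam n G Λ := Real.sqrt_nonneg _
  -- The maxima keep `C` nonnegative for all arguments and are inactive when `A ≥ 0` and `B ≥ K_Λ`.
  refine ⟨fun A B ↦ max A 0 * max B (CosmologyFlow.KLam n G Λ),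
    fun A B ↦ mul_nonneg (le_max_right _ _) (hK0.trans (le_max_right _ _)),
    fun A B hA hB ↦ congrArg₂ (· * ·) (max_eq_left hA) (max_eq_left hB), ?_⟩
  intro M _ _ _ _ _ _ X _ hS 𝒩 τ c₀ hX c _ S _ _ _ _ _ y lam₀ hlam₀ h hτ
  have hbound : ∀ x, ∀ lam ∈ Ico 0 lam₀, X.t (y lam x) ≤ (⨆ x', X.t (y 0 x'))
      + max (sSup (X.lapseInv '' (X.region ∩ {p | τ p ≤ c}))) 0
        * max (⨆ x', X.hypersurfaceK (y 0) x') (CosmologyFlow.KLam n G Λ) * lam :=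
    fun x lam hlam ↦ h.height_le (hK0.trans (le_max_right _ _))
      (fun s hs x ↦ (le_csSup (hX.bounded_below_level c)
        (mem_image_of_mem _ ⟨h.mapsTo s hs x, (hτ s hs x).le⟩)).trans (le_max_left _ _))
      (fun s hs x ↦ h.hypersurfaceK_le hn hG hΛ hS hs x) hlam x
  refine ⟨hbound, fun x q hq ↦ ?_⟩
  -- At `lam₀` the bound is the limit of the bounds before it, by continuity of `t`.
  refine le_of_tendsto_of_tendsto ((X.t_smooth.continuous.tendsto q).comp hq)
    ((Continuous.tendsto (by fun_prop : Continuous fun lam : ℝ ↦ (⨆ x', X.t (y 0 x'))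
      + max (sSup (X.lapseInv '' (X.region ∩ {p | τ p ≤ c}))) 0
        * max (⨆ x', X.hypersurfaceK (y 0) x') (CosmologyFlow.KLam n G Λ) * lam) lam₀).mono_left
      nhdsWithin_le_nhds) ?_
  filter_upwards [Ioo_mem_nhdsLT hlam₀] with lam hlam
  exact hbound x lam (Ioo_subset_Ico_self hlam)
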